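/- Let $A$ be a finite set of applicants (rows) and $B$ a set of houses (elements). A $k$-column preference matrix $M$ assigns to every row $a\in A$ a list $M(a,1),\dots,M(a,k)$ of $k$ distinct elements of $B$, most preferred first. A matching lets every row either choose one element of its list or stay unassigned, no element being chosen twice; a row prefers earlier elements, and being unassigned is worst. A blocking coalition of a matching $\tau$ is a non-empty set $A'\subseteq A$ for which there is a matching $\tau'$ that differs from $\tau$ only on $A'$ and is strictly better for every member of $A'$; $\tau$ is a Pareto optimal matching (POM) if it has no blocking coalition. A set $D\subseteq B$ is reachable if some POM selects every element of $D$; an element is avoidable if some POM does not select it. The row-element graph of $M$ is the bipartite graph on $A\sqcup B$ in which a row is adjacent to the elements of its list. Theorem. The problem "given a $2$-column matrix $M$ and a set $D$ of elements, is $D$ reachable?" is in P: for matrices over natural-number elements, with $M$ written row by row and $D$ as a list, all numbers in binary, the language of the encodings of the yes-instances is decided by a Turing machine in a number of steps polynomial in the length of the input word. Moreover, let $M$ be a $2$-column preference matrix with finitely many rows. A set $D\subseteq B$ is reachable if and only if $D\cap X_C$ is reachable for every connected component $C$ of the row-element graph, where $X_C$ denotes the set of elements in $C$. For every component $C$, with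 $m_C$ rows: 1. $X_C$ is finite and $|X_C|\le m_C+1$, with equality if and only if $C$ is a tree; 2. if $C$ is a tree, then for every $D\subseteq B$ the set $D\cap X_C$ is reachable if and only if some avoidable element of $X_C$ is not in $D$; 3. if $C$ is not a tree, then $X_C$ is reachable. -/

import Mathlib

/-! A preference matrix with rows `A`, `k` columns and houses (elements) `B` is a map
`M : Matrix A (Fin k) B` no row of which contains a house twice: `M a j` is the `j`-th most
preferred house of the applicant `a`. With few columns the lists are incomplete and
applicants may stay unassigned. -/

namespace HouseAllocation

/-- No row contains a house twice. -/
def IsPreferenceMatrix {A B : Type*} {k : ℕ} (M : Matrix A (Fin k) B) : Prop :=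
  ∀ a, Function.Injective (M a)

/-- A matching: every row chooses a position (column) in its own list, or stays unassigned (`⊤`),
and no two rows choose the same house. -/
structure Matching {A B : Type*} {k : ℕ} (M : Matrix A (Fin k) B) where
  /-- the position chosen in each row; `⊤` means that the row is unassigned -/
  pos : A → WithTop (Fin k)
  /-- a house is chosen by at most one row -/
  inj : ∀ (a a' : A) (j j' : Fin k), pos a = j → pos a' = j' → M a j = M a' j' → a = a'

namespace Matching

variable {A B : Type*} {k : ℕ} {M : Matrix A (Fin k) B}

/-- The set of houses that are selected by a matching. -/
def image (τ : Matching M) : Set B := {b | ∃ (a : A) (j : Fin k), τ.pos a = j ∧ M a j = b}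

/-- `S` is a blocking coalition of `τ`: some matching that differs from `τ` only on `S` is strictly
better for every member of `S` (further left is better, and unassigned is worst). -/
def IsBlockingCoalition (τ : Matching M) (S : Set A) : Prop :=
  S.Nonempty ∧ ∃ τ' : Matching M, (∀ a, a ∉ S → τ'.pos a = τ.pos a) ∧ ∀ a ∈ S, τ'.pos a < τ.pos a

/-- Pareto optimal matchings. -/
def IsParetoOptimal (τ : Matching M) : Prop := ∀ S : Set A, ¬ τ.IsBlockingCoalition S

end Matching

section

variable {A B : Type*} {k : ℕ} (M : Matrix A (Fin k) B)

/-- A set of houses is reachable if some Pareto optimal matching selects all of them. -/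
def Reachable (D : Set B) : Prop := ∃ τ : Matching M, τ.IsParetoOptimal ∧ D ⊆ τ.image

/-- A house is avoidable if some Pareto optimal matching does not select it. -/
def Avoidable (x : B) : Prop := ∃ τ : Matching M, τ.IsParetoOptimal ∧ x ∉ τ.image

/-- The bipartite row-element graph: a row is adjacent to the elements that appear in it. -/
def rowElementGraph : SimpleGraph (A ⊕ B) :=
  SimpleGraph.fromRel fun u v => ∃ (a : A) (j : Fin k), u = Sum.inl a ∧ v = Sum.inr (M a j)

variable {M}

/-- The rows in a component of the row-element graph. -/
def componentRows (C : (rowElementGraph M).ConnectedComponent) : Set A := {a | Sum.inl a ∈ C.supp}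

/-- The elements in a component of the row-element graph. -/
def componentElements (C : (rowElementGraph M).ConnectedComponent) : Set B :=
  {b | Sum.inr b ∈ C.supp}

end

/-! The decision problem, with houses named by natural numbers. -/

open Computability in
/-- A house followed by a comma, the house being written in binary (least significant
digit first). -/
def encodeHouse (x : ℕ) : List Γ' := (encodeNat x).map Γ'.bit ++ [Γ'.comma]

open Computability in
/-- The input word of an instance: the rows of the matrix, each between brackets, then the houses
to be reached, in the order of the list `D`; for example
`[1,2,][3,1,]2,3,` (shown here with decimal digits). -/
def encodeInstance {m k : ℕ} (M : Matrix (Fin m) (Fin k) ℕ) (D : List ℕ) : List Γ' :=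
  ((List.finRange m).flatMap fun i =>
    [Γ'.bra] ++ ((List.finRange k).flatMap fun j => encodeHouse (M i j)) ++ [Γ'.ket]) ++
  D.flatMap encodeHouse

/-- The language of the problem "Deciding Reachability" for matrices with `k` columns: the words
that encode (any number of rows) a preference matrix and a list of the members of a reachable
set. -/
def decidingReachability (k : ℕ) : Language Computability.Γ' :=
  {w | ∃ (m : ℕ) (M : Matrix (Fin m) (Fin k) ℕ) (D : List ℕ),
    w = encodeInstance M D ∧ IsPreferenceMatrix M ∧ Reachable M {x | x ∈ D}}

open Classical in
/-- The complexity class P: some Turing machine decides, for every word over the alphabet, whether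
it belongs to `L`, in a number of steps bounded by a polynomial in the length of the word. -/
def InP {Γ : Type} (L : Language Γ) : Prop :=
  Nonempty (Turing.TM2ComputableInPolyTime (id : List Γ → List Γ) Computability.encodeBool
    fun w => decide (w ∈ L))

end HouseAllocation

open Turing Computability

namespace HouseAllocation

/-! Everything rests on the equivalence `reachable_iff_covers`: with two columns, `D` is reachable
if and only if every row can pick one of its two entries, repetitions allowed, so that all of `D`
and all first-column elements are picked. A Pareto optimal matching selects every first-column
element, because a row whose favourite is free blocks alone. Conversely, thin a choice out to a
matching and improve it to a Pareto optimal one. Rows assigned before can only move from column 1 to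
column 0, and a counting argument on the moving rows shows that whatever they abandon is a favourite
of some row, hence still selected.

Picking is a question about the multigraph on the elements whose edges are the rows, so it splits
over components. In a component, all elements but an arbitrary `x` can be picked, each row taking
its entry farther from `x` (`covers_componentElements_diff`). Hence there are at most `m_C + 1`
elements. The component has `2 * m_C` edges, so equality characterises trees. In a tree some element
must be left out, and those that can be are exactly the ones outside the first column, the avoidable
ones. In the other components Hall's condition holds, and everything is picked.

For membership in P, picking is decided by contracting one row after another
(`saturable_iff_contractAll_eq_nil`): identify the two entries, and keep the merged element as a
need only if both entries were needed. The needs never become more numerous or longer, so the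
procedure is polynomial. It is run on the binary words themselves by a structured program over
stacks, which compiles to a Turing machine with a step count equal to the number of loop tests, up
to one. -/

/-- Every row can pick one of its two elements so that all of `Y` is picked. -/
def Covers {A B : Type*} (M : Matrix A (Fin 2) B) (Y : Set B) : Prop :=
  ∃ g : A → Fin 2, Y ⊆ Set.range fun a => M a (g a)

/-- The elements of the first column. -/
def firstColumn {A B : Type*} (M : Matrix A (Fin 2) B) : Set B := Set.range fun a => M a 0

/-! ### Pareto optimality and picking one element per row -/

section Matchings

variable {A B : Type*}

/-- Among the rows that pick the same element, one representative keeps it and the others become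
unassigned; the set of picked elements does not shrink. -/
theorem exists_matching_of_choice {k : ℕ} (M : Matrix A (Fin k) B) (g : A → Fin k) :
    ∃ τ : Matching M, Set.range (fun a => M a (g a)) ⊆ τ.image := by
  classical
  let f : A → B := fun a => M a (g a)
  let rep : A → A := fun a => Set.rangeSplitting f ⟨f a, a, rfl⟩
  have hrep : ∀ a, f (rep a) = f a := fun a => Set.apply_rangeSplitting f ⟨f a, a, rfl⟩
  have hcongr : ∀ a b, f a = f b → rep a = rep b := by
    intro a b h
    simp only [rep, h]
  refine ⟨⟨fun a => if rep a = a then (g a : WithTop (Fin k)) else ⊤, ?_⟩, ?_⟩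
  · intro a a' j j' h h' hj
    by_cases ha : rep a = a
    · by_cases ha' : rep a' = a'
      · rw [if_pos ha, WithTop.coe_inj] at h
        rw [if_pos ha', WithTop.coe_inj] at h'
        subst h h'
        rw [← ha, ← ha', hcongr a a' hj]
      · simp [ha'] at h'
    · simp [ha] at h
  · rintro _ ⟨a, rfl⟩
    refine ⟨rep a, g (rep a), ?_, hrep a⟩
    have : rep (rep a) = rep a := hcongr _ _ (hrep a)
    simp [this]

/-- The position vectors form a well-founded order, and a blocking coalition of a minimal one would
produce a smaller one. -/
theorem exists_paretoOptimal_le [Finite A] {k : ℕ} {M : Matrix A (Fin k) B} (τ : Matching M) :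
    ∃ τ' : Matching M, τ'.IsParetoOptimal ∧ ∀ a, τ'.pos a ≤ τ.pos a := by
  obtain ⟨p, ⟨τ', hle, rfl⟩, hmin⟩ := (wellFounded_lt (α := A → WithTop (Fin k))).has_min
    {p | ∃ τ' : Matching M, (∀ a, τ'.pos a ≤ τ.pos a) ∧ τ'.pos = p} ⟨_, τ, fun _ => le_rfl, rfl⟩
  refine ⟨τ', ?_, hle⟩
  rintro S ⟨⟨a, ha⟩, τ'', hout, hin⟩
  have hle' : ∀ a, τ''.pos a ≤ τ'.pos a := fun a => by
    by_cases h : a ∈ S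
    · exact (hin a h).le
    · exact (hout a h).le
  exact hmin τ''.pos ⟨τ'', fun a => (hle' a).trans (hle a), rfl⟩
    (Pi.lt_def.2 ⟨hle', a, hin a ha⟩)

variable {M : Matrix A (Fin 2) B}

theorem Matching.IsParetoOptimal.firstColumn_subset {τ : Matching M} (hτ : τ.IsParetoOptimal) :
    firstColumn M ⊆ τ.image := by
  classical
  rintro _ ⟨a, rfl⟩
  by_contra hx
  have hx' : ∀ (b : A) (j : Fin 2), τ.pos b = j → M b j ≠ M a 0 := fun b j h h' => hx ⟨b, j, h, h'⟩
  refine hτ {a} ⟨⟨a, rfl⟩, ⟨Function.update τ.pos a ((0 : Fin 2) : WithTop (Fin 2)), ?_⟩, ?_, ?_⟩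
  · intro b b' j j' h h' hj
    by_cases hb : b = a <;> by_cases hb' : b' = a
    · rw [hb, hb']
    · subst hb
      rw [Function.update_self, WithTop.coe_inj] at h
      rw [Function.update_of_ne hb'] at h'
      subst h
      exact absurd hj.symm (hx' _ _ h')
    · subst hb'
      rw [Function.update_self, WithTop.coe_inj] at h'
      rw [Function.update_of_ne hb] at h
      subst h'
      exact absurd hj (hx' _ _ h)
    · rw [Function.update_of_ne hb] at h
      rw [Function.update_of_ne hb'] at h'
      exact τ.inj b b' j j' h h' hj
  · intro b hb
    exact Function.update_of_ne hb _ _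
  · rintro b rfl
    simp only [Function.update_self]
    refine lt_of_le_of_ne ?_ fun h => hx ⟨b, 0, h.symm, rfl⟩
    cases h : τ.pos b with
    | top => exact le_top
    | coe j => exact WithTop.coe_le_coe.2 (Fin.zero_le j)

theorem Matching.image_subset_range (τ : Matching M) :
    τ.image ⊆ Set.range fun a => M a ((τ.pos a).untopD 0) := by
  rintro _ ⟨a, j, h, rfl⟩
  exact ⟨a, by simp [h]⟩

/-- Let `τ` select all that is picked and let `τ'` be a Pareto optimal improvement. Each row that
newly obtains its favourite takes it from a row that in turn newly obtains its own. This gives an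
injective self-map of a finite set, so every row moving from column 1 to column 0 is such a
predecessor and the element it abandons is a favourite. -/
theorem exists_paretoOptimal_of_covers [Finite A] {Y : Set B} (hM : IsPreferenceMatrix M)
    (hY : Covers M (Y ∪ firstColumn M)) : Reachable M Y := by
  obtain ⟨g, hg⟩ := hY
  obtain ⟨τ, hτ⟩ := exists_matching_of_choice M g
  obtain ⟨τ', hpo, hle⟩ := exists_paretoOptimal_le τ
  refine ⟨τ', hpo, fun x hx => ?_⟩
  obtain ⟨a, j, haj, rfl⟩ := hτ (hg (Or.inl hx))
  by_cases hj : τ'.pos a = j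
  · exact ⟨a, j, hj, rfl⟩
  -- Only here is it essential that there are two columns: strict improvement from an assigned
  -- position can only go from 1 to 0.
  have key : ∀ b (i : Fin 2), τ.pos b = i → τ'.pos b ≠ i → i = 1 ∧ τ'.pos b = (0 : Fin 2) := by
    intro b i hb hb'
    have := lt_of_le_of_ne (hb ▸ hle b) hb'
    cases h : τ'.pos b with
    | top => rw [h] at this; simp at this
    | coe i' =>
      rw [h, WithTop.coe_lt_coe] at this
      have h1 : i = 1 := by omega
      have h2 : i' = 0 := by omega
      exact ⟨h1, by rw [h2]⟩
  let S := {b : A | τ'.pos b = (0 : Fin 2) ∧ τ.pos b ≠ (0 : Fin 2)}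
  -- `t` is the row that held the favourite of `s` in `τ`. It cannot hold it in `τ'`, where `s`
  -- does, so it has moved and lies in `S`.
  have hf : ∀ s : S, ∃ t : S, ∃ i : Fin 2, τ.pos t = i ∧ M t i = M s 0 := by
    rintro ⟨s, hs0, hs1⟩
    obtain ⟨t, i, hti, ht⟩ := hτ (hg (Or.inr ⟨s, rfl⟩))
    have hne : t ≠ s := by
      rintro rfl
      rw [hM t ht] at hti
      exact hs1 hti
    have : τ'.pos t ≠ i := fun h => hne (τ'.inj t s i 0 h hs0 ht)
    obtain ⟨rfl, h0⟩ := key t i hti this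
    exact ⟨⟨t, h0, by rw [hti]; decide⟩, 1, hti, ht⟩
  choose f i hfi hf using hf
  have hinj : Function.Injective f := by
    intro s s' h
    have h1 := hfi s
    rw [h, hfi s'] at h1
    have h2 := hf s
    rw [h, ← WithTop.coe_inj.1 h1, hf s'] at h2
    exact Subtype.ext (τ'.inj s s' 0 0 s.2.1 s'.2.1 h2.symm)
  obtain ⟨rfl, h0⟩ := key a j haj hj
  -- By surjectivity the moving row `a` is the predecessor of some `s`, so what `a` gave up is the
  -- favourite of `s`.
  obtain ⟨s, hs⟩ := Finite.injective_iff_surjective.1 hinj ⟨a, h0, by rw [haj]; decide⟩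
  have h1 := hfi s
  have h2 := hf s
  rw [hs] at h1 h2
  rw [haj] at h1
  rw [← WithTop.coe_inj.1 h1] at h2
  exact hpo.firstColumn_subset ⟨s, h2.symm⟩

theorem reachable_iff_covers [Finite A] (hM : IsPreferenceMatrix M) {D : Set B} :
    Reachable M D ↔ Covers M (D ∪ firstColumn M) := by
  refine ⟨?_, exists_paretoOptimal_of_covers hM⟩
  rintro ⟨τ, hτ, hD⟩
  exact ⟨_, (Set.union_subset hD hτ.firstColumn_subset).trans τ.image_subset_range⟩

end Matchings

/-! ### Components of the row-element graph -/

section Components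

variable {A B : Type*} {M : Matrix A (Fin 2) B}

theorem rowElementGraph_adj_inl_inr {a : A} {b : B} :
    (rowElementGraph M).Adj (Sum.inl a) (Sum.inr b) ↔ ∃ j, M a j = b := by
  simp [rowElementGraph, eq_comm]

theorem rowElementGraph_not_adj_inl {a a' : A} :
    ¬ (rowElementGraph M).Adj (Sum.inl a) (Sum.inl a') := by
  simp [rowElementGraph]

theorem rowElementGraph_not_adj_inr {b b' : B} :
    ¬ (rowElementGraph M).Adj (Sum.inr b) (Sum.inr b') := by
  simp [rowElementGraph]

theorem mem_componentElements_iff (C : (rowElementGraph M).ConnectedComponent) (a : A)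
    (j : Fin 2) : M a j ∈ componentElements C ↔ a ∈ componentRows C := by
  have h : (rowElementGraph M).Adj (Sum.inl a) (Sum.inr (M a j)) :=
    rowElementGraph_adj_inl_inr.2 ⟨j, rfl⟩
  exact (C.mem_supp_congr_adj h).symm

/-- Both entries of a row lie in the component of that row, so choices made for different components
do not interfere and can be glued. -/
theorem covers_iff_forall_component {Y : Set B} :
    Covers M Y ↔ ∀ C : (rowElementGraph M).ConnectedComponent,
      Covers M (Y ∩ componentElements C) := by
  refine ⟨fun ⟨g, hg⟩ C => ⟨g, Set.inter_subset_left.trans hg⟩, fun h => ?_⟩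
  choose g hg using h
  refine ⟨fun a => g ((rowElementGraph M).connectedComponentMk (Sum.inl a)) a, fun y hy => ?_⟩
  have hyC : y ∈ componentElements ((rowElementGraph M).connectedComponentMk (Sum.inr y)) := by
    simp [componentElements]
  obtain ⟨a, ha⟩ := hg _ ⟨hy, hyC⟩
  dsimp only at ha
  refine ⟨a, ?_⟩
  have : a ∈ componentRows ((rowElementGraph M).connectedComponentMk (Sum.inr y)) := by
    rw [← mem_componentElements_iff _ a, ha]
    exact hyC
  have h' : (rowElementGraph M).connectedComponentMk (Sum.inl a) =
    (rowElementGraph M).connectedComponentMk (Sum.inr y) := this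
  simpa [h'] using ha

theorem componentElements_disjoint {C C' : (rowElementGraph M).ConnectedComponent} {x : B}
    (h : x ∈ componentElements C) (h' : x ∈ componentElements C') : C = C' :=
  SimpleGraph.ConnectedComponent.eq_of_common_vertex h h'

/-- Outside `C` only the first column has to be picked, which choosing column 0 everywhere achieves;
so only the constraints inside `C` matter. -/
theorem reachable_inter_iff_covers [Finite A] (hM : IsPreferenceMatrix M) (D : Set B)
    (C : (rowElementGraph M).ConnectedComponent) :
    Reachable M (D ∩ componentElements C) ↔
      Covers M ((D ∪ firstColumn M) ∩ componentElements C) := by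
  rw [reachable_iff_covers hM]
  constructor
  · rintro ⟨g, hg⟩
    refine ⟨g, subset_trans ?_ hg⟩
    rintro x ⟨hx | hx, hxC⟩
    · exact Or.inl ⟨hx, hxC⟩
    · exact Or.inr hx
  · intro h
    rw [covers_iff_forall_component]
    intro C'
    by_cases hC : C' = C
    · subst hC
      obtain ⟨g, hg⟩ := h
      refine ⟨g, subset_trans ?_ hg⟩
      rintro x ⟨hx | hx, hxC⟩
      · exact ⟨Or.inl hx.1, hxC⟩
      · exact ⟨Or.inr hx, hxC⟩
    · refine ⟨fun _ => 0, ?_⟩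
      rintro x ⟨hx | hx, hxC⟩
      · exact absurd (componentElements_disjoint hxC hx.2) hC
      · exact hx

theorem reachable_iff_forall_component [Finite A] (hM : IsPreferenceMatrix M) (D : Set B) :
    Reachable M D ↔ ∀ C : (rowElementGraph M).ConnectedComponent,
      Reachable M (D ∩ componentElements C) := by
  simp only [reachable_inter_iff_covers hM, reachable_iff_covers hM (D := D)]
  exact covers_iff_forall_component

theorem exists_adj_dist_lt {V : Type*} {G : SimpleGraph V} {x y : V} (h : G.Reachable y x)
    (hne : y ≠ x) : ∃ u, G.Adj y u ∧ G.Reachable u x ∧ G.dist u x < G.dist y x := by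
  obtain ⟨p, hp⟩ := h.exists_walk_length_eq_dist
  cases p with
  | nil => exact absurd rfl hne
  | @cons _ u _ hadj q =>
    refine ⟨u, hadj, ⟨q⟩, ?_⟩
    have := SimpleGraph.dist_le q
    simp only [SimpleGraph.Walk.length_cons] at hp
    omega

/-- In a component all elements but one can be picked: every row picks the element that is
farther from the exceptional one. -/
theorem covers_componentElements_diff (C : (rowElementGraph M).ConnectedComponent) {x : B}
    (hx : x ∈ componentElements C) : Covers M (componentElements C \ {x}) := by
  let d : B → ℕ := fun b => (rowElementGraph M).dist (Sum.inr b) (Sum.inr x)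
  refine ⟨fun a => if d (M a 0) < d (M a 1) then 1 else 0, ?_⟩
  rintro y ⟨hy, hyx⟩
  have hr : (rowElementGraph M).Reachable (Sum.inr y) (Sum.inr x) :=
    C.reachable_of_mem_supp hy hx
  -- Two steps along a shortest path from `y` to `x` lead through a row `a` to its other entry,
  -- which is closer to `x`; so `y` is the farther entry of `a`.
  obtain ⟨u, hyu, hu, hlt⟩ := exists_adj_dist_lt hr (by simpa using hyx)
  rcases u with a | b
  · obtain ⟨v, huv, -, hlt'⟩ := exists_adj_dist_lt hu (by simp)
    rcases v with a' | z
    · exact absurd huv rowElementGraph_not_adj_inl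
    · obtain ⟨j, rfl⟩ := rowElementGraph_adj_inl_inr.1 hyu.symm
      obtain ⟨i, rfl⟩ := rowElementGraph_adj_inl_inr.1 huv
      have hd : d (M a i) < d (M a j) := hlt'.trans hlt
      refine ⟨a, ?_⟩
      fin_cases j <;> fin_cases i <;> simp_all [not_lt_of_gt]
  · exact absurd hyu rowElementGraph_not_adj_inr

theorem exists_pick_subset_image (C : (rowElementGraph M).ConnectedComponent) {g : A → Fin 2}
    {Y : Set B} (hY : Y ⊆ componentElements C) (hg : Y ⊆ Set.range fun a => M a (g a)) :
    Y ⊆ (fun a => M a (g a)) '' componentRows C := by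
  intro y hy
  obtain ⟨a, rfl⟩ := hg hy
  exact ⟨a, (mem_componentElements_iff C a (g a)).1 (hY hy), rfl⟩

/-- The vertices of a component are its rows and its elements. -/
def suppEquiv (C : (rowElementGraph M).ConnectedComponent) :
    C ≃ componentRows C ⊕ componentElements C where
  toFun v := match v with
    | ⟨Sum.inl a, h⟩ => Sum.inl ⟨a, h⟩
    | ⟨Sum.inr b, h⟩ => Sum.inr ⟨b, h⟩
  invFun w := match w with
    | Sum.inl a => ⟨Sum.inl a, a.2⟩
    | Sum.inr b => ⟨Sum.inr b, b.2⟩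
  left_inv := by rintro ⟨a | b, h⟩ <;> rfl
  right_inv := by rintro (a | b) <;> rfl

/-- Edges correspond to pairs of a row and a column; injectivity uses that the entries of a row are
distinct. -/
theorem card_edgeSet_component (hM : IsPreferenceMatrix M)
    (C : (rowElementGraph M).ConnectedComponent) :
    Nat.card C.toSimpleGraph.edgeSet = 2 * (componentRows C).ncard := by
  let e : componentRows C × Fin 2 → C.toSimpleGraph.edgeSet := fun p =>
    ⟨s(⟨Sum.inl p.1, p.1.2⟩, ⟨Sum.inr (M p.1 p.2), (mem_componentElements_iff C _ _).2 p.1.2⟩),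
      (C.toSimpleGraph_adj _ _).2 (rowElementGraph_adj_inl_inr.2 ⟨p.2, rfl⟩)⟩
  have he : Function.Bijective e := by
    constructor
    · rintro ⟨⟨a, ha⟩, j⟩ ⟨⟨a', ha'⟩, j'⟩ h
      rcases Sym2.eq_iff.1 (Subtype.mk.inj h) with ⟨h1, h2⟩ | ⟨h1, -⟩
      · obtain rfl := Sum.inl.inj (congrArg Subtype.val h1)
        obtain rfl := hM a (Sum.inr.inj (congrArg Subtype.val h2))
        rfl
      · exact absurd (congrArg Subtype.val h1) (by simp)
    · rintro ⟨s, hs⟩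
      induction s with
      | h u v =>
        obtain ⟨u, hu⟩ := u
        obtain ⟨v, hv⟩ := v
        rw [SimpleGraph.mem_edgeSet, C.toSimpleGraph_adj] at hs
        rcases u with a | b <;> rcases v with a' | b'
        · exact absurd hs rowElementGraph_not_adj_inl
        · obtain ⟨j, rfl⟩ := rowElementGraph_adj_inl_inr.1 hs
          exact ⟨(⟨a, hu⟩, j), rfl⟩
        · obtain ⟨j, rfl⟩ := rowElementGraph_adj_inl_inr.1 hs.symm
          exact ⟨(⟨a', hv⟩, j), Subtype.ext Sym2.eq_swap⟩
        · exact absurd hs rowElementGraph_not_adj_inr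
  rw [← Nat.card_congr (Equiv.ofBijective e he), Nat.card_prod, Nat.card_coe_set_eq,
    Nat.card_eq_fintype_card, Fintype.card_fin, mul_comm]

variable [Finite A]

theorem ncard_le_of_covers (C : (rowElementGraph M).ConnectedComponent) {g : A → Fin 2}
    {Y : Set B} (hY : Y ⊆ componentElements C) (hg : Y ⊆ Set.range fun a => M a (g a)) :
    Y.ncard ≤ (componentRows C).ncard :=
  (Set.ncard_le_ncard (exists_pick_subset_image C hY hg) (Set.toFinite _)).trans
    (Set.ncard_image_le (Set.toFinite _))

theorem componentElements_finite (C : (rowElementGraph M).ConnectedComponent) :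
    (componentElements C).Finite := by
  rcases (componentElements C).eq_empty_or_nonempty with h | ⟨x, hx⟩
  · rw [h]; exact Set.finite_empty
  · obtain ⟨g, hg⟩ := covers_componentElements_diff C hx
    exact Set.Finite.of_sdiff ((Set.finite_range _).subset hg) (Set.finite_singleton x)

theorem ncard_componentElements_le (C : (rowElementGraph M).ConnectedComponent) :
    (componentElements C).ncard ≤ (componentRows C).ncard + 1 := by
  rcases (componentElements C).eq_empty_or_nonempty with h | ⟨x, hx⟩
  · simp [h]
  · obtain ⟨g, hg⟩ := covers_componentElements_diff C hx
    have := ncard_le_of_covers C Set.sdiff_subset hg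
    have h' := Set.ncard_sdiff_singleton_add_one hx (componentElements_finite C)
    omega

/-- A finite connected graph is a tree exactly when it has one more vertex than edges. Here there
are `m_C + |X_C|` vertices and `2 * m_C` edges. -/
theorem isTree_component_iff (hM : IsPreferenceMatrix M)
    (C : (rowElementGraph M).ConnectedComponent) :
    C.toSimpleGraph.IsTree ↔ (componentElements C).ncard = (componentRows C).ncard + 1 := by
  have := (componentElements_finite C).to_subtype
  have : Finite C := Finite.of_equiv _ (suppEquiv C).symm
  rw [SimpleGraph.isTree_iff_connected_and_card, card_edgeSet_component hM,
    Nat.card_congr (suppEquiv C), Nat.card_sum, Nat.card_coe_set_eq, Nat.card_coe_set_eq]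
  have := C.connected_toSimpleGraph
  constructor
  · rintro ⟨-, h⟩; omega
  · intro h; exact ⟨this, by omega⟩

/-- Only `m_C` of the `m_C + 1` elements can be selected, so a witnessing matching leaves one out,
which is then avoidable and not in `D`. Conversely, an avoidable `x` is not in the first column, so
picking all elements except `x` suffices. -/
theorem reachable_inter_iff_of_isTree (hM : IsPreferenceMatrix M)
    (C : (rowElementGraph M).ConnectedComponent) (hC : C.toSimpleGraph.IsTree) (D : Set B) :
    Reachable M (D ∩ componentElements C) ↔
      ∃ x ∈ componentElements C, Avoidable M x ∧ x ∉ D := by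
  constructor
  · rintro ⟨τ, hτ, hD⟩
    have hcard := (isTree_component_iff hM C).1 hC
    have : ∃ x ∈ componentElements C, x ∉ τ.image := by
      by_contra! h
      have := ncard_le_of_covers C subset_rfl
        (subset_trans (show componentElements C ⊆ τ.image from h) τ.image_subset_range)
      omega
    obtain ⟨x, hx, hxτ⟩ := this
    exact ⟨x, hx, ⟨τ, hτ, hxτ⟩, fun hxD => hxτ (hD ⟨hxD, hx⟩)⟩
  · rintro ⟨x, hx, ⟨τ, hτ, hxτ⟩, hxD⟩
    rw [reachable_inter_iff_covers hM]
    obtain ⟨g, hg⟩ := covers_componentElements_diff C hx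
    refine ⟨g, subset_trans ?_ hg⟩
    rintro y ⟨hy, hyC⟩
    refine ⟨hyC, ?_⟩
    rintro rfl
    rcases hy with hy | hy
    · exact hxD hy
    · exact hxτ (hτ.firstColumn_subset hy)

/-- Hall's theorem, matching elements to rows. A proper subset of the elements misses some `x` and
is picked by the choice that omits `x`, so it has enough adjacent rows; the full set is adjacent to
all rows of `C`, and the hypothesis counts these. -/
theorem covers_componentElements (C : (rowElementGraph M).ConnectedComponent)
    (hC : (componentElements C).ncard ≤ (componentRows C).ncard) :
    Covers M (componentElements C) := by
  classical
  have := Fintype.ofFinite A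
  have := (componentElements_finite C).fintype
  let t : componentElements C → Finset A := fun b => {a | ∃ j, M a j = b}
  obtain ⟨f, hf, hft⟩ := (Finset.all_card_le_biUnion_card_iff_exists_injective t).1 <| by
    intro s
    by_cases hs : s = Finset.univ
    · subst hs
      have h1 : (componentRows C).toFinset ⊆ Finset.univ.biUnion t := by
        intro a ha
        rw [Set.mem_toFinset] at ha
        simp only [Finset.mem_biUnion, t, Finset.mem_filter, Finset.mem_univ, true_and]
        exact ⟨⟨M a 0, (mem_componentElements_iff C a 0).2 ha⟩, 0, rfl⟩
      refine le_trans ?_ (Finset.card_le_card h1)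
      rw [← Set.ncard_eq_toFinset_card', Finset.card_univ, ← Nat.card_eq_fintype_card,
        Nat.card_coe_set_eq]
      exact hC
    · obtain ⟨x, hx⟩ : ∃ x, x ∉ s := by
        by_contra! h
        exact hs (Finset.eq_univ_of_forall h)
      obtain ⟨g, hg⟩ := covers_componentElements_diff C x.2
      have h1 : s.map (Function.Embedding.subtype _) ⊆
          (s.biUnion t).image fun a => M a (g a) := by
        intro y hy
        obtain ⟨b, hb, rfl⟩ := Finset.mem_map.1 hy
        have hbx : b ≠ x := by rintro rfl; exact hx hb
        obtain ⟨a, ha⟩ := hg ⟨b.2, fun h => hbx (Subtype.ext h)⟩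
        refine Finset.mem_image.2 ⟨a, Finset.mem_biUnion.2 ⟨b, hb, ?_⟩, ha⟩
        simp only [t, Finset.mem_filter, Finset.mem_univ, true_and]
        exact ⟨_, ha⟩
      have h2 := (Finset.card_le_card h1).trans Finset.card_image_le
      rwa [Finset.card_map] at h2
  -- An injective assignment of rows to elements is turned back into a choice of columns; rows not
  -- used take column 0.
  have : ∀ a, ∃ j, ∀ b, f b = a → M a j = b := by
    intro a
    by_cases h : ∃ b, f b = a
    · obtain ⟨b, rfl⟩ := h
      obtain ⟨j, hj⟩ := (Finset.mem_filter.1 (hft b)).2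
      exact ⟨j, fun b' hb' => by rw [hf hb', hj]⟩
    · exact ⟨0, fun b hb => absurd ⟨b, hb⟩ h⟩
  choose g hg using this
  exact ⟨g, fun b hb => ⟨f ⟨b, hb⟩, hg _ ⟨b, hb⟩ rfl⟩⟩

theorem reachable_componentElements_of_not_isTree (hM : IsPreferenceMatrix M)
    (C : (rowElementGraph M).ConnectedComponent) (hC : ¬ C.toSimpleGraph.IsTree) :
    Reachable M (componentElements C) := by
  have h := reachable_inter_iff_covers hM Set.univ C
  rw [Set.univ_inter] at h
  rw [h, Set.univ_union, Set.univ_inter]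
  apply covers_componentElements
  rw [isTree_component_iff hM] at hC
  have := ncard_componentElements_le C
  omega

end Components

/-! ### Deciding picks by contracting rows -/

section Contraction

variable {α : Type*}

/-- Every pair of `R` can pick one of its entries so that all members of `T` are picked. -/
def Saturable (R : List (α × α)) (T : List α) : Prop :=
  ∃ g : List α, List.Forall₂ (fun e x => x = e.1 ∨ x = e.2) R g ∧ T ⊆ g

variable [DecidableEq α]

/-- Replace `q` by `p`. -/
def rename (q p x : α) : α := if x = q then p else x

theorem rename_eq_self_of_ne {q p t x : α} (ht : t ≠ p) (h : rename q p x = t) : x = t := by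
  unfold rename at h
  split_ifs at h with hx
  · exact absurd h.symm ht
  · exact h

theorem eq_or_eq_of_rename_eq {q p x : α} (h : rename q p x = p) : x = p ∨ x = q := by
  unfold rename at h
  split_ifs at h with hx
  · exact Or.inr hx
  · exact Or.inl h

/-- The elements that remain to be picked after the pair `(p, q)` is contracted to `p`. -/
def contractNeeds (p q : α) (T : List α) : List α :=
  let T' := (T.filter (· ≠ p)).filter (· ≠ q)
  if p ∈ T ∧ q ∈ T.filter (· ≠ p) then p :: T' else T'

/-- Contract the pairs one after the other. -/
def contractAll : List (α × α) → List α → List α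
  | [], T => T
  | (p, q) :: R, T =>
    contractAll (R.map (Prod.map (rename q p) (rename q p))) (contractNeeds p q T)
termination_by R => R.length

theorem forall₂_map_rename {q p : α} {R : List (α × α)} {g : List α}
    (h : List.Forall₂ (fun e x => x = e.1 ∨ x = e.2) R g) :
    List.Forall₂ (fun e x => x = e.1 ∨ x = e.2)
      (R.map (Prod.map (rename q p) (rename q p))) (g.map (rename q p)) := by
  rw [List.forall₂_map_left_iff, List.forall₂_map_right_iff]
  refine h.imp ?_
  rintro e x (rfl | rfl)
  · exact Or.inl rfl
  · exact Or.inr rfl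

theorem exists_forall₂_of_map_rename {q p : α} {R : List (α × α)} {g : List α}
    (h : List.Forall₂ (fun e x => x = e.1 ∨ x = e.2)
      (R.map (Prod.map (rename q p) (rename q p))) g) :
    ∃ g', List.Forall₂ (fun e x => x = e.1 ∨ x = e.2) R g' ∧ g'.map (rename q p) = g := by
  induction R generalizing g with
  | nil =>
    cases h
    exact ⟨[], .nil, rfl⟩
  | cons e R ih =>
    cases h with
    | @cons _ x _ g h1 h2 =>
      obtain ⟨g', hg', rfl⟩ := ih h2
      rcases h1 with rfl | rfl
      · exact ⟨e.1 :: g', .cons (Or.inl rfl) hg', rfl⟩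
      · exact ⟨e.2 :: g', .cons (Or.inr rfl) hg', rfl⟩

theorem mem_contractNeeds {p q t : α} {T : List α} :
    t ∈ contractNeeds p q T ↔
      (t ∈ T ∧ t ≠ p ∧ t ≠ q) ∨ (t = p ∧ p ∈ T ∧ q ∈ T ∧ q ≠ p) := by
  unfold contractNeeds
  simp only [List.mem_filter, decide_eq_true_eq]
  split_ifs with h
  · simp only [List.mem_cons, List.mem_filter, decide_eq_true_eq]
    tauto
  · simp only [List.mem_filter, decide_eq_true_eq]
    tauto

/-- The pair `(p, q)` can serve either of its entries. If at most one of them is needed, the pair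
takes care of it. If both are, some other pair has to pick one of them, no matter which, and this is
the demand on the merged element. A pair that has become a loop `(p, p)` just removes `p`. -/
theorem saturable_cons_iff (p q : α) (R : List (α × α)) (T : List α) :
    Saturable ((p, q) :: R) T ↔
      Saturable (R.map (Prod.map (rename q p) (rename q p))) (contractNeeds p q T) := by
  constructor
  · rintro ⟨_, h, hT⟩
    cases h with
    | @cons _ x _ g h1 h2 =>
      refine ⟨_, forall₂_map_rename h2, fun t ht => List.mem_map.2 ?_⟩
      rcases mem_contractNeeds.1 ht with ⟨ht, hp, hq⟩ | ⟨rfl, hp, hq, hne⟩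
      · refine ⟨t, ?_, by simp [rename, hq]⟩
        rcases List.mem_cons.1 (hT ht) with rfl | h
        · rcases h1 with rfl | rfl <;> contradiction
        · exact h
      · rcases List.mem_cons.1 (hT hp) with rfl | h
        · rcases List.mem_cons.1 (hT hq) with h' | h'
          · exact absurd h' hne
          · exact ⟨q, h', by simp [rename]⟩
        · exact ⟨t, h, by simp [rename]⟩
  · rintro ⟨g, h, hT⟩
    obtain ⟨g, hg, rfl⟩ := exists_forall₂_of_map_rename h
    have hrest : ∀ t ∈ T, t ≠ p → t ≠ q → t ∈ g := by
      intro t ht hp hq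
      obtain ⟨x, hx, hxt⟩ := List.mem_map.1 (hT (mem_contractNeeds.2 (Or.inl ⟨ht, hp, hq⟩)))
      rwa [← rename_eq_self_of_ne hp hxt]
    by_cases hboth : p ∈ T ∧ q ∈ T ∧ q ≠ p
    · obtain ⟨x, hx, hxp⟩ := List.mem_map.1 (hT (mem_contractNeeds.2 (Or.inr ⟨rfl, hboth⟩)))
      -- The merged element was picked elsewhere as `p` or as `q`; the contracted pair picks the
      -- other one.
      rcases eq_or_eq_of_rename_eq hxp with rfl | rfl
      · refine ⟨q :: g, .cons (Or.inr rfl) hg, fun t ht => ?_⟩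
        by_cases h1 : t = q
        · simp [h1]
        · by_cases h2 : t = x
          · simp [h2, hx]
          · exact List.mem_cons_of_mem _ (hrest t ht h2 h1)
      · refine ⟨p :: g, .cons (Or.inl rfl) hg, fun t ht => ?_⟩
        by_cases h1 : t = p
        · simp [h1]
        · by_cases h2 : t = x
          · simp [h2, hx]
          · exact List.mem_cons_of_mem _ (hrest t ht h1 h2)
    · by_cases hp : p ∈ T
      · refine ⟨p :: g, .cons (Or.inl rfl) hg, fun t ht => ?_⟩
        by_cases h1 : t = p
        · simp [h1]
        · refine List.mem_cons_of_mem _ (hrest t ht h1 ?_)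
          rintro rfl
          exact hboth ⟨hp, ht, h1⟩
      · refine ⟨q :: g, .cons (Or.inr rfl) hg, fun t ht => ?_⟩
        by_cases h1 : t = q
        · simp [h1]
        · refine List.mem_cons_of_mem _ (hrest t ht ?_ h1)
          rintro rfl
          exact hp ht

theorem saturable_iff_contractAll_eq_nil (R : List (α × α)) (T : List α) :
    Saturable R T ↔ contractAll R T = [] := by
  induction hn : R.length generalizing R T with
  | zero =>
    obtain rfl := List.length_eq_zero_iff.1 hn
    rw [contractAll]
    constructor
    · rintro ⟨g, h, hT⟩
      cases h
      exact List.subset_nil.1 hT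
    · rintro rfl
      exact ⟨[], .nil, List.Subset.refl _⟩
  | succ n ih =>
    match R, hn with
    | (p, q) :: R, hn =>
      rw [saturable_cons_iff, ih _ _ (by simpa using hn), contractAll]

-- The order inside a pair is irrelevant; the program relies on this, since it exchanges the entries
-- when it checks the rows.
omit [DecidableEq α] in
theorem saturable_map_swap_iff {R : List (α × α)} {T : List α} :
    Saturable (R.map Prod.swap) T ↔ Saturable R T := by
  simp only [Saturable, List.forall₂_map_left_iff, Prod.fst_swap, Prod.snd_swap, or_comm]

end Contraction

/-! ### From matrices to lists of pairs -/

section Instances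

theorem covers_iff_saturable {α : Type*} {m : ℕ} (M : Matrix (Fin m) (Fin 2) α) (T : List α) :
    Covers M {x | x ∈ T} ↔ Saturable ((List.finRange m).map fun i => (M i 0, M i 1)) T := by
  constructor
  · rintro ⟨g, hg⟩
    refine ⟨(List.finRange m).map fun i => M i (g i), ?_, fun t ht => ?_⟩
    · rw [List.forall₂_map_left_iff, List.forall₂_map_right_iff, List.forall₂_same]
      intro i _
      generalize g i = j
      fin_cases j <;> simp
    · obtain ⟨i, hi⟩ := hg ht
      exact List.mem_map.2 ⟨i, List.mem_finRange i, hi⟩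
  · rintro ⟨g, hg, hT⟩
    have hlen : g.length = m := by simpa using hg.length_eq.symm
    subst hlen
    have : ∀ i : Fin g.length, ∃ j, M i j = g[i] := by
      intro i
      have := (List.forall₂_iff_get.1 hg).2 i (by simp) i.2
      simp only [List.get_eq_getElem, List.getElem_map, List.getElem_finRange] at this
      rcases this with h | h
      · exact ⟨0, h.symm⟩
      · exact ⟨1, h.symm⟩
    choose f hf using this
    refine ⟨f, fun t ht => ?_⟩
    obtain ⟨i, hi, rfl⟩ := List.mem_iff_getElem.1 (hT ht)
    exact ⟨⟨i, hi⟩, hf ⟨i, hi⟩⟩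

/-- Renaming elements injectively is harmless, so the decision can be made on binary words instead
of numbers. -/
theorem saturable_map_iff {α β : Type*} {f : α → β} (hf : Function.Injective f)
    (R : List (α × α)) (T : List α) :
    Saturable (R.map (Prod.map f f)) (T.map f) ↔ Saturable R T := by
  constructor
  · rintro ⟨g, hg, hT⟩
    have : ∃ g', List.Forall₂ (fun e x => x = e.1 ∨ x = e.2) R g' ∧ g'.map f = g := by
      clear hT
      induction R generalizing g with
      | nil => cases hg; exact ⟨[], .nil, rfl⟩
      | cons e R ih =>
        cases hg with
        | @cons _ x _ g h1 h2 =>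
          obtain ⟨g', hg', rfl⟩ := ih _ h2
          rcases h1 with rfl | rfl
          · exact ⟨e.1 :: g', .cons (Or.inl rfl) hg', rfl⟩
          · exact ⟨e.2 :: g', .cons (Or.inr rfl) hg', rfl⟩
    obtain ⟨g', hg', rfl⟩ := this
    refine ⟨g', hg', fun t ht => ?_⟩
    obtain ⟨x, hx, hxt⟩ := List.mem_map.1 (hT (List.mem_map_of_mem ht))
    rwa [← hf hxt]
  · rintro ⟨g, hg, hT⟩
    refine ⟨g.map f, ?_, List.map_subset f hT⟩
    rw [List.forall₂_map_left_iff, List.forall₂_map_right_iff]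
    refine hg.imp ?_
    rintro e x (rfl | rfl)
    · exact Or.inl rfl
    · exact Or.inr rfl

theorem reachable_iff_contractAll {m : ℕ} {M : Matrix (Fin m) (Fin 2) ℕ}
    (hM : IsPreferenceMatrix M) (D : List ℕ) {β : Type*} [DecidableEq β] {f : ℕ → β}
    (hf : Function.Injective f) :
    Reachable M {x | x ∈ D} ↔
      contractAll ((List.finRange m).map fun i => (f (M i 0), f (M i 1)))
        (((List.finRange m).map fun i => f (M i 0)) ++ D.map f) = [] := by
  rw [← saturable_iff_contractAll_eq_nil, reachable_iff_covers hM]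
  have h1 : ({x | x ∈ D} ∪ firstColumn M : Set ℕ) =
      {x | x ∈ ((List.finRange m).map fun i => M i 0) ++ D} := by
    ext x
    simp [firstColumn, or_comm]
  rw [h1, covers_iff_saturable, ← saturable_map_iff hf, List.map_map, List.map_append,
    List.map_map]
  rfl

end Instances

/-! ### Structured programs and their compilation to Turing machines -/

/-- Structured programs over stacks indexed by `K` with alphabet `Γ`, and a register in `σ`. -/
inductive Prog (K Γ σ : Type) : Type
  | skip : Prog K Γ σ
  | push : K → (σ → Γ) → Prog K Γ σ
  | peek : K → (σ → Option Γ → σ) → Prog K Γ σ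
  | pop : K → (σ → Option Γ → σ) → Prog K Γ σ
  | load : (σ → σ) → Prog K Γ σ
  | seq : Prog K Γ σ → Prog K Γ σ → Prog K Γ σ
  | ite : (σ → Bool) → Prog K Γ σ → Prog K Γ σ → Prog K Γ σ
  /-- `loop k f p c`: peek at the stack `k`, updating the register by `f`; as long as `p` holds of
  the register, run `c` and repeat. -/
  | loop : K → (σ → Option Γ → σ) → (σ → Bool) → Prog K Γ σ → Prog K Γ σ

namespace Prog

variable {K Γ σ : Type}

/-- The labels of the Turing machine that a program is compiled to, one for each loop. -/
def Labels : Prog K Γ σ → Type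
  | seq c d => c.Labels ⊕ d.Labels
  | ite _ c d => c.Labels ⊕ d.Labels
  | loop _ _ _ c => Option c.Labels
  | _ => Empty

instance finite_labels : ∀ c : Prog K Γ σ, Finite c.Labels
  | skip | push _ _ | peek _ _ | pop _ _ | load _ => inferInstanceAs (Finite Empty)
  | seq c d | ite _ c d =>
    have := finite_labels c
    have := finite_labels d
    inferInstanceAs (Finite (c.Labels ⊕ d.Labels))
  | loop _ _ _ c =>
    have := finite_labels c
    inferInstanceAs (Finite (Option c.Labels))

/-- The alphabets of the stacks of the machine, the one with index `none` being for the output. -/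
def Alphabet (Γ : Type) : Option K → Type
  | none => Bool
  | some _ => Γ

/-- The stacks of the machine, with empty output stack. -/
def machineStacks (S : K → List Γ) : ∀ k : Option K, List (Alphabet Γ k)
  | none => []
  | some k => S k

/-- The statement that runs the program and continues with `q`. -/
def compile {Λ : Type} : (c : Prog K Γ σ) → (c.Labels → Λ) →
    TM2.Stmt (Alphabet (K := K) Γ) Λ σ → TM2.Stmt (Alphabet (K := K) Γ) Λ σ
  | skip, _, q => q
  | push k f, _, q => .push (some k) f q
  | peek k f, _, q => .peek (some k) f q
  | pop k f, _, q => .pop (some k) f q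
  | load f, _, q => .load f q
  | seq c d, ι, q => c.compile (fun l => ι (Sum.inl l)) (d.compile (fun l => ι (Sum.inr l)) q)
  | ite p c d, ι, q =>
    .branch p (c.compile (fun l => ι (Sum.inl l)) q) (d.compile (fun l => ι (Sum.inr l)) q)
  | loop _ _ _ _, ι, _ => .goto fun _ => ι none

/-- The statements at the labels of a compiled program. -/
def table {Λ : Type} : (c : Prog K Γ σ) → (c.Labels → Λ) →
    TM2.Stmt (Alphabet (K := K) Γ) Λ σ → c.Labels → TM2.Stmt (Alphabet (K := K) Γ) Λ σ
  | seq c d, ι, q, Sum.inl l =>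
    c.table (fun l => ι (Sum.inl l)) (d.compile (fun l => ι (Sum.inr l)) q) l
  | seq _ d, ι, q, Sum.inr l => d.table (fun l => ι (Sum.inr l)) q l
  | ite _ c _, ι, q, Sum.inl l => c.table (fun l => ι (Sum.inl l)) q l
  | ite _ _ d, ι, q, Sum.inr l => d.table (fun l => ι (Sum.inr l)) q l
  | loop k f p c, ι, q, none =>
    .peek (some k) f (.branch p (c.compile (fun l => ι (some l)) (.goto fun _ => ι none)) q)
  | loop _ _ _ c, ι, _, some l => c.table (fun l => ι (some l)) (.goto fun _ => ι none) l

variable [DecidableEq K]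

/-- `Exec c v S v' S' t`: the program `c`, started with register `v` and stacks `S`, ends with
`v'` and `S'` after at most `t` tests of loop conditions. -/
inductive Exec : Prog K Γ σ → σ → (K → List Γ) → σ → (K → List Γ) → ℕ → Prop
  | skip (v : σ) (S : K → List Γ) : Exec .skip v S v S 0
  | push (k : K) (f : σ → Γ) (v : σ) (S : K → List Γ) :
    Exec (.push k f) v S v (Function.update S k (f v :: S k)) 0
  | peek (k : K) (f : σ → Option Γ → σ) (v : σ) (S : K → List Γ) :
    Exec (.peek k f) v S (f v (S k).head?) S 0
  | pop (k : K) (f : σ → Option Γ → σ) (v : σ) (S : K → List Γ) :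
    Exec (.pop k f) v S (f v (S k).head?) (Function.update S k (S k).tail) 0
  | load (f : σ → σ) (v : σ) (S : K → List Γ) : Exec (.load f) v S (f v) S 0
  | seq {c d : Prog K Γ σ} {v v' v'' : σ} {S S' S'' : K → List Γ} {s t : ℕ} :
    Exec c v S v' S' s → Exec d v' S' v'' S'' t → Exec (.seq c d) v S v'' S'' (s + t)
  | ite_true {p : σ → Bool} {c d : Prog K Γ σ} {v v' : σ} {S S' : K → List Γ} {t : ℕ} :
    p v = true → Exec c v S v' S' t → Exec (.ite p c d) v S v' S' t
  | ite_false {p : σ → Bool} {c d : Prog K Γ σ} {v v' : σ} {S S' : K → List Γ} {t : ℕ} :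
    p v = false → Exec d v S v' S' t → Exec (.ite p c d) v S v' S' t
  | loop_exit {k : K} {f : σ → Option Γ → σ} {p : σ → Bool} {c : Prog K Γ σ} {v : σ}
    {S : K → List Γ} :
    p (f v (S k).head?) = false → Exec (.loop k f p c) v S (f v (S k).head?) S 1
  | loop_step {k : K} {f : σ → Option Γ → σ} {p : σ → Bool} {c : Prog K Γ σ} {v v' v'' : σ}
    {S S' S'' : K → List Γ} {s t : ℕ} :
    p (f v (S k).head?) = true → Exec c (f v (S k).head?) S v' S' s →
    Exec (.loop k f p c) v' S' v'' S'' t → Exec (.loop k f p c) v S v'' S'' (s + t + 1)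
  | weaken {c : Prog K Γ σ} {v v' : σ} {S S' : K → List Γ} {s t : ℕ} :
    Exec c v S v' S' s → s ≤ t → Exec c v S v' S' t

theorem update_machineStacks (S : K → List Γ) (k : K) (l : List Γ) :
    Function.update (machineStacks S) (some k) l = machineStacks (Function.update S k l) := by
  funext j
  cases j with
  | none => exact Function.update_of_ne (by simp) _ _
  | some j =>
    by_cases h : j = k
    · subst h
      exact (Function.update_self _ _ _).trans
        (Function.update_self (β := fun _ => List Γ) j l S).symm
    · exact (Function.update_of_ne (by simpa using h) _ _).trans
        (Function.update_of_ne (β := fun _ => List Γ) h l S).symm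

/-- `b` is reached from `a` in at most `t` steps. -/
def StepsWithin {κ : Type*} (f : κ → Option κ) (t : ℕ) (a b : κ) : Prop :=
  ∃ n ≤ t, (flip bind f)^[n] (some a) = some b

theorem StepsWithin.refl {κ : Type*} {f : κ → Option κ} (a : κ) : StepsWithin f 0 a a :=
  ⟨0, le_rfl, rfl⟩

theorem StepsWithin.trans {κ : Type*} {f : κ → Option κ} {s t : ℕ} {a b c : κ}
    (h : StepsWithin f s a b) (h' : StepsWithin f t b c) : StepsWithin f (s + t) a c := by
  obtain ⟨n, hn, h⟩ := h
  obtain ⟨m, hm, h'⟩ := h'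
  refine ⟨m + n, by omega, ?_⟩
  rw [Function.iterate_add_apply, h, h']

theorem StepsWithin.single {κ : Type*} {f : κ → Option κ} {a b : κ} (h : f a = some b) :
    StepsWithin f 1 a b :=
  ⟨1, le_rfl, h⟩

theorem StepsWithin.mono {κ : Type*} {f : κ → Option κ} {s t : ℕ} {a b : κ}
    (h : StepsWithin f s a b) (hst : s ≤ t) : StepsWithin f t a b :=
  let ⟨n, hn, h⟩ := h
  ⟨n, hn.trans hst, h⟩

/-- One machine step runs a statement up to the next jump, and jumps occur only at loop heads, so
loop tests are all that is counted. The continuation `q` must vary in the induction: a program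
followed by another, or a loop body, continues with different code. -/
theorem stepsWithin_of_exec {c : Prog K Γ σ} {v v' : σ} {S S' : K → List Γ} {t : ℕ}
    (h : Exec c v S v' S' t) {Λ : Type} (m : Λ → TM2.Stmt (Alphabet (K := K) Γ) Λ σ)
    (ι : c.Labels → Λ) (q : TM2.Stmt (Alphabet (K := K) Γ) Λ σ)
    (hm : ∀ l, m (ι l) = c.table ι q l) :
    StepsWithin (TM2.step m) t (TM2.stepAux (c.compile ι q) v (machineStacks S))
      (TM2.stepAux q v' (machineStacks S')) := by
  induction h generalizing q with
  | skip v S => exact .refl _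
  | push k f v S =>
    simp only [compile, TM2.stepAux]
    rw [← update_machineStacks]
    exact .refl _
  | peek k f v S => exact .refl _
  | pop k f v S =>
    simp only [compile, TM2.stepAux]
    rw [← update_machineStacks]
    exact .refl _
  | load f v S => exact .refl _
  | seq _ _ ih₁ ih₂ =>
    exact (ih₁ _ _ fun l => hm (Sum.inl l)).trans (ih₂ _ _ fun l => hm (Sum.inr l))
  | ite_true hp _ ih =>
    simp only [compile, TM2.stepAux, hp, cond_true]
    exact ih _ _ fun l => hm (Sum.inl l)
  | ite_false hp _ ih =>
    simp only [compile, TM2.stepAux, hp, cond_false]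
    exact ih _ _ fun l => hm (Sum.inr l)
  | @loop_exit k f p c v S hp =>
    refine .single ?_
    simp only [compile, TM2.stepAux, TM2.step]
    rw [hm none]
    simp only [table, TM2.stepAux]
    exact congrArg (fun b => some (bif b then _ else _)) hp
  | @loop_step k f p c v v' v'' S S' S'' s t hp _ _ ih₁ ih₂ =>
    have h1 : StepsWithin (TM2.step m) 1
        (TM2.stepAux ((loop k f p c).compile ι q) v (machineStacks S))
        (TM2.stepAux (c.compile (fun l => ι (some l)) (.goto fun _ => ι none)) (f v (S k).head?)
          (machineStacks S)) := by
      refine .single ?_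
      simp only [compile, TM2.stepAux, TM2.step]
      rw [hm none]
      simp only [table, TM2.stepAux]
      exact congrArg (fun b => some (bif b then _ else _)) hp
    have h2 := h1.trans ((ih₁ (fun l => ι (some l)) _ fun l => hm (some l)).trans (ih₂ ι q hm))
    exact h2.mono (by omega)
  | weaken _ hst ih => exact (ih ι q hm).mono hst

/-- The machine that runs a program on the input in the stack `k₀` and outputs a bit of the
final register. -/
noncomputable def machine [Fintype K] [Fintype σ] [Fintype Γ] (c : Prog K Γ σ) (k₀ : K) (v₀ : σ)
    (ans : σ → Bool) : FinTM2 where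
  K := Option K
  k₀ := some k₀
  k₁ := none
  Γ := Alphabet Γ
  Λ := Option c.Labels
  main := none
  ΛFin := Fintype.ofFinite _
  σ := σ
  initialState := v₀
  Γk₀Fin := inferInstanceAs (Fintype Γ)
  m
    | none => c.compile some (.push none ans (.load (fun _ => v₀) .halt))
    | some l => c.table some (.push none ans (.load (fun _ => v₀) .halt)) l

theorem inP_of_exec [Fintype K] [Fintype σ] [Fintype Γ] (c : Prog K Γ σ) (k₀ : K) (v₀ : σ)
    (ans : σ → Bool) (L : Language Γ) (time : Polynomial ℕ)
    (h : ∀ w : List Γ, ∃ v', Exec c v₀ (Function.update (fun _ => []) k₀ w) v' (fun _ => [])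
      (time.eval w.length) ∧ (ans v' = true ↔ w ∈ L)) : InP L := by
  classical
  -- The extra step leaves the main label. The final configuration must have the initial register
  -- and nothing but the output on its stacks, hence the reset to `v₀` and the requirement that
  -- programs end with empty stacks.
  refine ⟨⟨⟨c.machine k₀ v₀ ans, Equiv.refl _, Equiv.refl _⟩, time + 1, fun w => ?_⟩⟩
  refine Classical.choice ?_
  obtain ⟨v', hex, hans⟩ := h w
  have h1 := stepsWithin_of_exec hex (c.machine k₀ v₀ ans).m some
    (.push none ans (.load (fun _ => v₀) .halt)) fun _ => rfl
  have h0 : StepsWithin (c.machine k₀ v₀ ans).step 1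
      (initList (c.machine k₀ v₀ ans) (List.map id w))
      (TM2.stepAux (c.compile some (.push none ans (.load (fun _ => v₀) .halt))) v₀
        (machineStacks (Function.update (fun _ => []) k₀ w))) := by
    refine .single ?_
    have : initList (c.machine k₀ v₀ ans) (List.map id w) =
        ⟨some none, v₀, machineStacks (Function.update (fun _ => []) k₀ w)⟩ := by
      unfold initList
      congr 1
      funext k
      rcases k with _ | k
      · exact dif_neg (by simp [machine])
      · by_cases hk : k = k₀
        · subst hk
          refine (dif_pos rfl).trans ?_
          exact (List.map_id w).trans
            (Function.update_self (β := fun _ => List Γ) k w (fun _ => [])).symm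
        · refine (dif_neg (by simpa [machine] using hk)).trans ?_
          exact (Function.update_of_ne (β := fun _ => List Γ) hk w (fun _ => [])).symm
    rw [this]
    rfl
  obtain ⟨n, hn, h2⟩ := h0.trans h1
  refine ⟨⟨⟨n, ?_⟩, ?_⟩⟩
  · refine h2.trans (congrArg some ?_)
    have hd : decide (w ∈ L) = ans v' := by
      rw [Bool.eq_iff_iff, decide_eq_true_iff, hans]
    rw [hd]
    unfold haltList
    simp only [TM2.stepAux]
    refine congrArg (TM2.Cfg.mk none v₀) ?_
    funext k
    rcases k with _ | k
    · refine (Function.update_self _ _ _).trans (Eq.trans ?_ (dif_pos rfl).symm)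
      rfl
    · refine (Function.update_of_ne (Option.some_ne_none k) _ _).trans (Eq.trans ?_ (dif_neg ?_).symm)
      · rfl
      · exact Option.some_ne_none k
  · simp only [Polynomial.eval_add, Polynomial.eval_one]
    simp only [id]
    omega

/-- Programs without loops. -/
def loopFree : Prog K Γ σ → Bool
  | seq c d => c.loopFree && d.loopFree
  | ite _ c d => c.loopFree && d.loopFree
  | loop _ _ _ _ => false
  | _ => true

/-- The effect of a program without loops. -/
def eval : Prog K Γ σ → σ × (K → List Γ) → σ × (K → List Γ)
  | skip, s => s
  | push k f, s => (s.1, Function.update s.2 k (f s.1 :: s.2 k))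
  | peek k f, s => (f s.1 (s.2 k).head?, s.2)
  | pop k f, s => (f s.1 (s.2 k).head?, Function.update s.2 k (s.2 k).tail)
  | load f, s => (f s.1, s.2)
  | seq c d, s => d.eval (c.eval s)
  | ite p c d, s => bif p s.1 then c.eval s else d.eval s
  | loop _ _ _ _, s => s

theorem exec_eval {c : Prog K Γ σ} (h : c.loopFree = true) (v : σ) (S : K → List Γ) :
    Exec c v S (c.eval (v, S)).1 (c.eval (v, S)).2 0 := by
  induction c generalizing v S with
  | skip => exact .skip v S
  | push k f => exact .push k f v S
  | peek k f => exact .peek k f v S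
  | pop k f => exact .pop k f v S
  | load f => exact .load f v S
  | seq c d ihc ihd =>
    rw [loopFree, Bool.and_eq_true] at h
    exact .seq (ihc h.1 v S) (ihd h.2 _ _)
  | ite p c d ihc ihd =>
    rw [loopFree, Bool.and_eq_true] at h
    simp only [eval]
    cases hp : p v with
    | true => exact .ite_true hp (ihc h.1 v S)
    | false => exact .ite_false hp (ihd h.2 v S)
  | loop => simp [loopFree] at h

theorem exec_of_eval_eq {c : Prog K Γ σ} (h : c.loopFree = true) {v v' : σ} {S S' : K → List Γ}
    (he : c.eval (v, S) = (v', S')) : Exec c v S v' S' 0 := by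
  have := exec_eval h v S
  rwa [he] at this

end Prog

/-! ### Recognising the words that encode instances -/

section Parsing

/-- A bit string followed by a comma. -/
def codeWord (b : List Bool) : List Γ' := b.map Γ'.bit ++ [Γ'.comma]

/-- A list of bit strings, each followed by a comma. -/
def code (l : List (List Bool)) : List Γ' := l.flatMap codeWord

/-- The word of an instance whose houses are given by bit strings. -/
def instanceWord (rows : List (List Bool × List Bool)) (D : List (List Bool)) : List Γ' :=
  (rows.flatMap fun e => Γ'.bra :: (codeWord e.1 ++ codeWord e.2 ++ [Γ'.ket])) ++ code D

/-- Bit strings that do not end with a zero. -/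
def Canonical (b : List Bool) : Prop := b.getLast? ≠ some false

/-- The part of the input that is being read: the start of a row, the first or the second element
of a row, the end of a row, the final list of elements, or an error. -/
inductive Phase
  | row | fst | snd | close | tail | bad
  deriving DecidableEq

instance : Fintype Phase where
  elems := {.row, .fst, .snd, .close, .tail, .bad}
  complete := by rintro (_ | _ | _ | _ | _ | _) <;> decide

/-- Transitions of the finite automaton that reads the input; the second component is the last
digit of the number being read. -/
def advance : Phase × Option Bool → Γ' → Phase × Option Bool
  | (.row, _), .bra => (.fst, none)
  | (.row, _), .bit b => (.tail, some b)
  | (.row, _), .comma => (.tail, none)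
  | (.fst, _), .bit b => (.fst, some b)
  | (.fst, some false), .comma => (.bad, none)
  | (.fst, _), .comma => (.snd, none)
  | (.snd, _), .bit b => (.snd, some b)
  | (.snd, some false), .comma => (.bad, none)
  | (.snd, _), .comma => (.close, none)
  | (.close, _), .ket => (.row, none)
  | (.tail, _), .bit b => (.tail, some b)
  | (.tail, some false), .comma => (.bad, none)
  | (.tail, _), .comma => (.tail, none)
  | _, _ => (.bad, none)

/-- The accepting states. -/
def accepting : Phase × Option Bool → Bool
  | (.row, _) => true
  | (.tail, none) => true
  | _ => false

/-- Whether a symbol belongs to an element in a row. -/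
def inRow (s : Phase × Option Bool) : Bool := s.1 == .fst || s.1 == .snd

/-- Whether a symbol belongs to the first element of a row or to the final list. -/
def inNeeds (s : Phase × Option Bool) (c : Γ') : Bool :=
  s.1 == .fst || s.1 == .tail || (s.1 == .row && c != .bra)

/-- The symbols of the elements in the rows. -/
def rowSymbols : Phase × Option Bool → List Γ' → List Γ'
  | _, [] => []
  | s, c :: w => if inRow s then c :: rowSymbols (advance s c) w else rowSymbols (advance s c) w

/-- The symbols of the first elements of the rows and of the final list. -/
def needSymbols : Phase × Option Bool → List Γ' → List Γ'
  | _, [] => []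
  | s, c :: w =>
    if inNeeds s c then c :: needSymbols (advance s c) w else needSymbols (advance s c) w

theorem length_rowSymbols_le (s : Phase × Option Bool) (w : List Γ') :
    (rowSymbols s w).length ≤ w.length := by
  induction w generalizing s with
  | nil => simp [rowSymbols]
  | cons c w ih =>
    have := ih (advance s c)
    rw [rowSymbols]
    split_ifs <;> simp only [List.length_cons] <;> omega

theorem length_needSymbols_le (s : Phase × Option Bool) (w : List Γ') :
    (needSymbols s w).length ≤ w.length := by
  induction w generalizing s with
  | nil => simp [needSymbols]
  | cons c w ih =>
    have := ih (advance s c)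
    rw [needSymbols]
    split_ifs <;> simp only [List.length_cons] <;> omega

/-- The digits `b` complete a canonical number whose digits so far end with `l`. -/
def Completes (l : Option Bool) (b : List Bool) : Prop := Canonical (l.toList ++ b)

theorem completes_cons {l : Option Bool} {b : Bool} {bs : List Bool} :
    Completes l (b :: bs) ↔ Completes (some b) bs := by
  cases l <;> simp [Completes, Canonical, List.getLast?_cons_cons]

theorem completes_nil {l : Option Bool} : Completes l [] ↔ l ≠ some false := by
  rcases l with _ | l <;> simp [Completes, Canonical]

theorem completes_none {b : List Bool} : Completes none b ↔ Canonical b := Iff.rfl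

/-- What an accepted word looks like that is read from a given state. -/
def Continues : Phase × Option Bool → List Γ' → Prop
  | (.row, _), w => ∃ rows D, (∀ e ∈ rows, Canonical e.1 ∧ Canonical e.2) ∧
      (∀ b ∈ D, Canonical b) ∧ w = instanceWord rows D
  | (.fst, l), w => ∃ b c rows D, Completes l b ∧ Canonical c ∧
      (∀ e ∈ rows, Canonical e.1 ∧ Canonical e.2) ∧ (∀ b ∈ D, Canonical b) ∧
      w = codeWord b ++ codeWord c ++ Γ'.ket :: instanceWord rows D
  | (.snd, l), w => ∃ c rows D, Completes l c ∧
      (∀ e ∈ rows, Canonical e.1 ∧ Canonical e.2) ∧ (∀ b ∈ D, Canonical b) ∧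
      w = codeWord c ++ Γ'.ket :: instanceWord rows D
  | (.close, _), w => ∃ rows D, (∀ e ∈ rows, Canonical e.1 ∧ Canonical e.2) ∧
      (∀ b ∈ D, Canonical b) ∧ w = Γ'.ket :: instanceWord rows D
  | (.tail, l), w => (l = none ∧ w = []) ∨ ∃ b D, Completes l b ∧ (∀ b ∈ D, Canonical b) ∧
      w = codeWord b ++ code D
  | (.bad, _), _ => False

/-- Soundness of the automaton, by induction on the word: each transition prepends its symbol to a
word of the shape that `Continues` prescribes for the next state. -/
theorem continues_of_accepting (w : List Γ') (s : Phase × Option Bool)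
    (h : accepting (w.foldl advance s) = true) : Continues s w := by
  induction w generalizing s with
  | nil =>
    rcases s with ⟨_ | _ | _ | _ | _ | _, _ | l⟩ <;> simp [accepting] at h
    · exact ⟨[], [], by simp, by simp, rfl⟩
    · exact ⟨[], [], by simp, by simp, rfl⟩
    · exact Or.inl ⟨rfl, rfl⟩
  | cons c w ih =>
    have hw := ih _ h
    clear ih h
    rcases s with ⟨_ | _ | _ | _ | _ | _, l⟩
    · rcases c with _ | b | _ | _ | _
      · exact hw.elim
      · rcases hw with ⟨h, -⟩ | ⟨bs, D, hb, hD, rfl⟩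
        · simp at h
        · refine ⟨[], (b :: bs) :: D, by simp, ?_, rfl⟩
          simp only [List.mem_cons, forall_eq_or_imp]
          exact ⟨completes_none.1 (completes_cons.2 hb), hD⟩
      · obtain ⟨b, c, rows, D, hb, hc, hr, hD, rfl⟩ := hw
        refine ⟨(b, c) :: rows, D, ?_, hD, ?_⟩
        · simp only [List.mem_cons, forall_eq_or_imp]
          exact ⟨⟨hb, hc⟩, hr⟩
        · simp [instanceWord]
      · exact hw.elim
      · rcases hw with ⟨-, rfl⟩ | ⟨bs, D, hb, hD, rfl⟩
        · exact ⟨[], [[]], by simp, by simp [Canonical], rfl⟩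
        · refine ⟨[], [] :: bs :: D, by simp, ?_, rfl⟩
          simp only [List.mem_cons, forall_eq_or_imp]
          exact ⟨by simp [Canonical], completes_none.1 hb, hD⟩
    · rcases c with _ | b | _ | _ | _
      · exact hw.elim
      · obtain ⟨bs, c, rows, D, hb, hc, hr, hD, rfl⟩ := hw
        exact ⟨b :: bs, c, rows, D, completes_cons.2 hb, hc, hr, hD, rfl⟩
      · exact hw.elim
      · exact hw.elim
      · rcases l with _ | _ | _
        · obtain ⟨c, rows, D, hc, hr, hD, rfl⟩ := hw
          exact ⟨[], c, rows, D, by simp [completes_nil], hc, hr, hD, rfl⟩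
        · exact hw.elim
        · obtain ⟨c, rows, D, hc, hr, hD, rfl⟩ := hw
          exact ⟨[], c, rows, D, by simp [completes_nil], hc, hr, hD, rfl⟩
    · rcases c with _ | b | _ | _ | _
      · exact hw.elim
      · obtain ⟨bs, rows, D, hb, hr, hD, rfl⟩ := hw
        exact ⟨b :: bs, rows, D, completes_cons.2 hb, hr, hD, rfl⟩
      · exact hw.elim
      · exact hw.elim
      · rcases l with _ | _ | _
        · obtain ⟨rows, D, hr, hD, rfl⟩ := hw
          exact ⟨[], rows, D, by simp [completes_nil], hr, hD, rfl⟩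
        · exact hw.elim
        · obtain ⟨rows, D, hr, hD, rfl⟩ := hw
          exact ⟨[], rows, D, by simp [completes_nil], hr, hD, rfl⟩
    · rcases c with _ | b | _ | _ | _
      · exact hw.elim
      · exact hw.elim
      · exact hw.elim
      · obtain ⟨rows, D, hr, hD, rfl⟩ := hw
        exact ⟨rows, D, hr, hD, rfl⟩
      · exact hw.elim
    · have hcomma : Continues (.tail, none) w → l ≠ some false →
          Continues (.tail, l) (Γ'.comma :: w) := by
        rintro (⟨-, rfl⟩ | ⟨bs, D, hb, hD, rfl⟩) hl
        · exact Or.inr ⟨[], [], completes_nil.2 hl, by simp, rfl⟩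
        · refine Or.inr ⟨[], bs :: D, completes_nil.2 hl, ?_, rfl⟩
          simp only [List.mem_cons, forall_eq_or_imp]
          exact ⟨completes_none.1 hb, hD⟩
      rcases c with _ | b | _ | _ | _
      · exact hw.elim
      · rcases hw with ⟨h, -⟩ | ⟨bs, D, hb, hD, rfl⟩
        · simp at h
        · exact Or.inr ⟨b :: bs, D, completes_cons.2 hb, hD, rfl⟩
      · exact hw.elim
      · exact hw.elim
      · rcases l with _ | _ | _
        · exact hcomma hw (by simp)
        · exact hw.elim
        · exact hcomma hw (by simp)
    · rcases c with _ | b | _ | _ | _ <;> exact hw.elim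

theorem read_fst {l : Option Bool} {b : List Bool} (hb : Completes l b) (w : List Γ') :
    (codeWord b ++ w).foldl advance (.fst, l) = w.foldl advance (.snd, none) ∧
    rowSymbols (.fst, l) (codeWord b ++ w) = codeWord b ++ rowSymbols (.snd, none) w ∧
    needSymbols (.fst, l) (codeWord b ++ w) = codeWord b ++ needSymbols (.snd, none) w := by
  induction b generalizing l with
  | nil =>
    rw [completes_nil] at hb
    rcases l with _ | _ | _
    · exact ⟨rfl, rfl, rfl⟩
    · exact absurd rfl hb
    · exact ⟨rfl, rfl, rfl⟩
  | cons d b ih =>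
    obtain ⟨h1, h2, h3⟩ := ih (completes_cons.1 hb)
    exact ⟨h1, congrArg (Γ'.bit d :: ·) h2, congrArg (Γ'.bit d :: ·) h3⟩

theorem read_snd {l : Option Bool} {b : List Bool} (hb : Completes l b) (w : List Γ') :
    (codeWord b ++ w).foldl advance (.snd, l) = w.foldl advance (.close, none) ∧
    rowSymbols (.snd, l) (codeWord b ++ w) = codeWord b ++ rowSymbols (.close, none) w ∧
    needSymbols (.snd, l) (codeWord b ++ w) = needSymbols (.close, none) w := by
  induction b generalizing l with
  | nil =>
    rw [completes_nil] at hb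
    rcases l with _ | _ | _
    · exact ⟨rfl, rfl, rfl⟩
    · exact absurd rfl hb
    · exact ⟨rfl, rfl, rfl⟩
  | cons d b ih =>
    obtain ⟨h1, h2, h3⟩ := ih (completes_cons.1 hb)
    exact ⟨h1, congrArg (Γ'.bit d :: ·) h2, h3⟩

theorem read_tail {l : Option Bool} {b : List Bool} (hb : Completes l b) (w : List Γ') :
    (codeWord b ++ w).foldl advance (.tail, l) = w.foldl advance (.tail, none) ∧
    rowSymbols (.tail, l) (codeWord b ++ w) = rowSymbols (.tail, none) w ∧
    needSymbols (.tail, l) (codeWord b ++ w) = codeWord b ++ needSymbols (.tail, none) w := by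
  induction b generalizing l with
  | nil =>
    rw [completes_nil] at hb
    rcases l with _ | _ | _
    · exact ⟨rfl, rfl, rfl⟩
    · exact absurd rfl hb
    · exact ⟨rfl, rfl, rfl⟩
  | cons d b ih =>
    obtain ⟨h1, h2, h3⟩ := ih (completes_cons.1 hb)
    exact ⟨h1, h2, congrArg (Γ'.bit d :: ·) h3⟩

theorem read_tail_code {D : List (List Bool)} (hD : ∀ b ∈ D, Canonical b) :
    accepting ((code D).foldl advance (.tail, none)) = true ∧
    rowSymbols (.tail, none) (code D) = [] ∧ needSymbols (.tail, none) (code D) = code D := by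
  induction D with
  | nil => exact ⟨rfl, rfl, rfl⟩
  | cons b D ih =>
    simp only [List.mem_cons, forall_eq_or_imp] at hD
    obtain ⟨h1, h2, h3⟩ := read_tail (l := none) hD.1 (code D)
    obtain ⟨h4, h5, h6⟩ := ih hD.2
    change accepting ((codeWord b ++ code D).foldl _ _) = true ∧
      rowSymbols _ (codeWord b ++ code D) = [] ∧
      needSymbols _ (codeWord b ++ code D) = codeWord b ++ code D
    rw [h1, h2, h3, h5, h6]
    exact ⟨h4, rfl, rfl⟩

/-- The final list begins while the automaton still expects a row; its first symbol leads to the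
same state as from the tail phase, and the empty list is accepted in both. -/
theorem read_row_code {D : List (List Bool)} (hD : ∀ b ∈ D, Canonical b) :
    accepting ((code D).foldl advance (.row, none)) = true ∧
    rowSymbols (.row, none) (code D) = [] ∧ needSymbols (.row, none) (code D) = code D := by
  have h := read_tail_code hD
  rcases D with _ | ⟨_ | ⟨d, b⟩, D⟩ <;> exact h

/-- The elements of the rows, one after the other. -/
def flatten {α : Type*} (rows : List (α × α)) : List α := rows.flatMap fun e => [e.1, e.2]

theorem read_instanceWord {rows : List (List Bool × List Bool)} {D : List (List Bool)}
    (hr : ∀ e ∈ rows, Canonical e.1 ∧ Canonical e.2) (hD : ∀ b ∈ D, Canonical b) :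
    accepting ((instanceWord rows D).foldl advance (.row, none)) = true ∧
    rowSymbols (.row, none) (instanceWord rows D) = code (flatten rows) ∧
    needSymbols (.row, none) (instanceWord rows D) = code (rows.map Prod.fst ++ D) := by
  induction rows with
  | nil => exact read_row_code hD
  | cons e rows ih =>
    simp only [List.mem_cons, forall_eq_or_imp] at hr
    obtain ⟨⟨he1, he2⟩, hr⟩ := hr
    obtain ⟨h1, h2, h3⟩ := read_fst (l := none) he1
      (codeWord e.2 ++ Γ'.ket :: instanceWord rows D)
    obtain ⟨h4, h5, h6⟩ := read_snd (l := none) he2 (Γ'.ket :: instanceWord rows D)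
    obtain ⟨h7, h8, h9⟩ := ih hr
    have hw : instanceWord (e :: rows) D =
        Γ'.bra :: (codeWord e.1 ++ (codeWord e.2 ++ Γ'.ket :: instanceWord rows D)) := by
      simp [instanceWord]
    rw [hw]
    refine ⟨?_, ?_, ?_⟩
    · change accepting (List.foldl advance (.fst, none) _) = true
      rw [h1, h4]
      exact h7
    · change rowSymbols (.fst, none) _ = _
      rw [h2, h5]
      change codeWord e.1 ++ (codeWord e.2 ++ rowSymbols (.row, none) (instanceWord rows D)) = _
      rw [h8]
      simp [code, flatten]
    · change needSymbols (.fst, none) _ = _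
      rw [h3, h6]
      change codeWord e.1 ++ needSymbols (.row, none) (instanceWord rows D) = _
      rw [h9]
      simp [code]

theorem encodePosNum_getLast? (n : PosNum) : (encodePosNum n).getLast? = some true := by
  induction n with
  | one => rfl
  | bit0 n ih => simp [encodePosNum, List.getLast?_cons, ih]
  | bit1 n ih => simp [encodePosNum, List.getLast?_cons, ih]

theorem canonical_encodeNat (n : ℕ) : Canonical (encodeNat n) := by
  unfold Canonical encodeNat encodeNum
  cases (n : Num) with
  | zero => simp
  | pos n => simp [encodePosNum_getLast?]

theorem encode_decodePosNum {b : List Bool} (hb : b.getLast? = some true) :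
    encodePosNum (decodePosNum b) = b := by
  induction b with
  | nil => simp at hb
  | cons d b ih =>
    rcases b with _ | ⟨d', b⟩
    · simp at hb
      subst hb
      rfl
    · rw [List.getLast?_cons_cons] at hb
      have := ih hb
      cases d with
      | false =>
        rw [decodePosNum, encodePosNum, this]
      | true =>
        rw [decodePosNum, if_neg (by simp), encodePosNum, this]

/-- The encodings of numbers are exactly the canonical strings: least significant digit first, the
last digit of a positive number is 1, and zero is the empty string. -/
theorem encode_decodeNat {b : List Bool} (hb : Canonical b) : encodeNat (decodeNat b) = b := by
  unfold decodeNat encodeNat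
  rw [Num.of_to_nat]
  unfold decodeNum encodeNum
  rcases b.eq_nil_or_concat with rfl | ⟨b', d, rfl⟩
  · rfl
  · have hd : d = true := by
      cases d
      · simp [Canonical] at hb
      · rfl
    subst hd
    rw [List.concat_eq_append, if_neg (by simp), PosNum.cast_to_num]
    exact encode_decodePosNum (by simp)

theorem encodeNat_injective : Function.Injective encodeNat :=
  Function.LeftInverse.injective decode_encodeNat

theorem encodeInstance_eq {m : ℕ} (M : Matrix (Fin m) (Fin 2) ℕ) (D : List ℕ) :
    encodeInstance M D = instanceWord
      ((List.finRange m).map fun i => (encodeNat (M i 0), encodeNat (M i 1)))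
      (D.map encodeNat) := by
  have : List.finRange 2 = [0, 1] := rfl
  simp [encodeInstance, instanceWord, code, List.flatMap_map, this, encodeHouse, codeWord]
  rfl

theorem exists_encodeInstance {rows : List (List Bool × List Bool)} {D : List (List Bool)}
    (hr : ∀ e ∈ rows, Canonical e.1 ∧ Canonical e.2) (hD : ∀ b ∈ D, Canonical b) :
    ∃ (m : ℕ) (M : Matrix (Fin m) (Fin 2) ℕ) (D' : List ℕ),
      rows = (List.finRange m).map (fun i => (encodeNat (M i 0), encodeNat (M i 1))) ∧
      D = D'.map encodeNat := by
  refine ⟨rows.length, fun i => ![decodeNat rows[i].1, decodeNat rows[i].2], D.map decodeNat,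
    ?_, ?_⟩
  · refine List.ext_getElem (by simp) fun i h1 h2 => ?_
    have := hr _ (List.getElem_mem h1)
    simp [encode_decodeNat this.1, encode_decodeNat this.2]
  · rw [List.map_map]
    refine (List.map_id D).symm.trans (List.map_congr_left fun b hb => ?_)
    exact (encode_decodeNat (hD b hb)).symm

theorem isPreferenceMatrix_iff {m : ℕ} (M : Matrix (Fin m) (Fin 2) ℕ) :
    IsPreferenceMatrix M ↔
      ∀ e ∈ (List.finRange m).map (fun i => (encodeNat (M i 0), encodeNat (M i 1))),
        e.1 ≠ e.2 := by
  simp only [List.mem_map, List.mem_finRange, true_and, forall_exists_index,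
    forall_apply_eq_imp_iff, encodeNat_injective.ne_iff]
  refine forall_congr' fun i => ⟨fun h h' => by simpa using h h', fun h j j' hj => ?_⟩
  fin_cases j <;> fin_cases j' <;> simp_all

/-- The specification of the program: syntax, distinct entries in each row, and the outcome of
contraction, all in terms of bit strings. -/
theorem mem_decidingReachability_iff {w : List Γ'} : w ∈ decidingReachability 2 ↔
    ∃ rows D, w = instanceWord rows D ∧ (∀ e ∈ rows, Canonical e.1 ∧ Canonical e.2) ∧
      (∀ b ∈ D, Canonical b) ∧ (∀ e ∈ rows, e.1 ≠ e.2) ∧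
      contractAll rows (rows.map Prod.fst ++ D) = [] := by
  constructor
  · rintro ⟨m, M, D, rfl, hM, hD⟩
    refine ⟨_, _, encodeInstance_eq M D, ?_, ?_, (isPreferenceMatrix_iff M).1 hM, ?_⟩
    · simp [canonical_encodeNat]
    · simp [canonical_encodeNat]
    · rw [List.map_map]
      exact (reachable_iff_contractAll hM D encodeNat_injective).1 hD
  · rintro ⟨rows, D, rfl, hr, hD, hne, h⟩
    obtain ⟨m, M, D, rfl, rfl⟩ := exists_encodeInstance hr hD
    have hM := (isPreferenceMatrix_iff M).2 hne
    refine ⟨m, M, D, (encodeInstance_eq M D).symm, hM, ?_⟩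
    rw [List.map_map] at h
    exact (reachable_iff_contractAll hM D encodeNat_injective).2 h

end Parsing

/-! ### Stacks and register of the decision program -/

/-- The stacks of the decision program: `X` holds the input and, later, the list that is being
scanned, `R` the rows, `T` the elements to be picked, `P` and `Q` single elements; `Y` and `Z` are
auxiliary. -/
inductive Stk
  | X | R | T | Y | Z | P | Q
  deriving DecidableEq

instance : Fintype Stk where
  elems := {.X, .R, .T, .Y, .Z, .P, .Q}
  complete := by rintro (_ | _ | _ | _ | _ | _ | _) <;> decide

/-- The register of the decision program: two symbols, the result of a comparison, two flags for
elements found, the answer, and the state of the automaton that reads the input. -/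
structure Reg where
  c : Option Γ'
  d : Option Γ'
  eq : Bool
  f : Bool
  g : Bool
  ok : Bool
  s : Phase × Option Bool

instance : Fintype Reg :=
  Fintype.ofEquiv (Option Γ' × Option Γ' × Bool × Bool × Bool × Bool × Phase × Option Bool)
    { toFun := fun a => ⟨a.1, a.2.1, a.2.2.1, a.2.2.2.1, a.2.2.2.2.1, a.2.2.2.2.2.1,
        a.2.2.2.2.2.2⟩
      invFun := fun v => (v.c, v.d, v.eq, v.f, v.g, v.ok, v.s)
      left_inv := fun _ => rfl
      right_inv := fun _ => rfl }

/-- Programs over these stacks and this register. -/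
abbrev Code := Prog Stk Γ' Reg

/-- The stacks with given contents. -/
def st (x r t y z p q : List Γ') : Stk → List Γ'
  | .X => x
  | .R => r
  | .T => t
  | .Y => y
  | .Z => z
  | .P => p
  | .Q => q

section Stacks

variable (x r t y z p q l : List Γ')

@[simp] theorem st_X : st x r t y z p q .X = x := rfl
@[simp] theorem st_R : st x r t y z p q .R = r := rfl
@[simp] theorem st_T : st x r t y z p q .T = t := rfl
@[simp] theorem st_Y : st x r t y z p q .Y = y := rfl
@[simp] theorem st_Z : st x r t y z p q .Z = z := rfl
@[simp] theorem st_P : st x r t y z p q .P = p := rfl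
@[simp] theorem st_Q : st x r t y z p q .Q = q := rfl

@[simp] theorem update_st_X : Function.update (st x r t y z p q) .X l = st l r t y z p q := by
  funext k; cases k <;> rfl
@[simp] theorem update_st_R : Function.update (st x r t y z p q) .R l = st x l t y z p q := by
  funext k; cases k <;> rfl
@[simp] theorem update_st_T : Function.update (st x r t y z p q) .T l = st x r l y z p q := by
  funext k; cases k <;> rfl
@[simp] theorem update_st_Y : Function.update (st x r t y z p q) .Y l = st x r t l z p q := by
  funext k; cases k <;> rfl
@[simp] theorem update_st_Z : Function.update (st x r t y z p q) .Z l = st x r t y l p q := by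
  funext k; cases k <;> rfl
@[simp] theorem update_st_P : Function.update (st x r t y z p q) .P l = st x r t y z l q := by
  funext k; cases k <;> rfl
@[simp] theorem update_st_Q : Function.update (st x r t y z p q) .Q l = st x r t y z p l := by
  funext k; cases k <;> rfl

end Stacks

open Prog (Exec)

/-! ### Moving and discarding symbols -/

/-- Whether a symbol is a digit. -/
def isBit : Option Γ' → Bool
  | some (.bit _) => true
  | _ => false

theorem isBit_of_mem_map {b : List Bool} {x : Γ'} (h : x ∈ b.map Γ'.bit) :
    isBit (some x) = true := by
  obtain ⟨d, -, rfl⟩ := List.mem_map.1 h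
  rfl

/-- A reversed coded list is empty or has a comma on top, so removing digits from `Y` stops exactly
at the previous word. -/
theorem isBit_head?_reverse_code (l : List (List Bool)) :
    isBit (code l).reverse.head? = false := by
  rcases l.eq_nil_or_concat with rfl | ⟨l', b, rfl⟩
  · rfl
  · simp [code, codeWord, isBit]

/-- Pop a symbol into the register. -/
def popSymbol (k : Stk) : Code := .pop k fun v o => { v with c := o }

/-- Push the symbol in the register. -/
def pushSymbol (k : Stk) : Code := .push k fun v => v.c.getD .blank

/-- Push a comma. -/
def pushComma (k : Stk) : Code := .push k fun _ => .comma

/-- Repeat while the top symbol of a stack satisfies a condition. -/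
def whileTop (p : Option Γ' → Bool) (k : Stk) (c : Code) : Code :=
  .loop k (fun v o => { v with c := o }) (fun v => p v.c) c

/-- Pop symbols from one stack and push them to another while a condition holds. -/
def transfer (p : Option Γ' → Bool) (a b : Stk) : Code :=
  whileTop p a (.seq (popSymbol a) (pushSymbol b))

/-- Pop symbols while a condition holds. -/
def discard (p : Option Γ' → Bool) (a : Stk) : Code := whileTop p a (popSymbol a)

theorem Prog.Exec.of_eq {c : Code} {v v' v'' : Reg} {S S' S'' : Stk → List Γ'} {t t' : ℕ}
    (h : Exec c v S v' S' t) (hv : v' = v'') (hS : S' = S'') (ht : t ≤ t') :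
    Exec c v S v'' S'' t' := by
  subst hv hS
  exact h.weaken ht

theorem exec_whileTop_exit {p : Option Γ' → Bool} {k : Stk} {c : Code} {v : Reg}
    {S : Stk → List Γ'} {o : Option Γ'} (hS : (S k).head? = o) (hp : p o = false) :
    Exec (whileTop p k c) v S { v with c := o } S 1 := by
  subst hS
  exact .loop_exit hp

theorem exec_whileTop_step {p : Option Γ' → Bool} {k : Stk} {c : Code} {v v' v'' : Reg}
    {S S' S'' : Stk → List Γ'} {s t : ℕ} {o : Option Γ'} (hS : (S k).head? = o)
    (hp : p o = true) (hc : Exec c { v with c := o } S v' S' s)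
    (h : Exec (whileTop p k c) v' S' v'' S'' t) :
    Exec (whileTop p k c) v S v'' S'' (s + t + 1) := by
  subst hS
  exact .loop_step hp hc h

theorem exec_transfer {p : Option Γ' → Bool} {a b : Stk} (hab : a ≠ b) {l rest : List Γ'}
    (hl : ∀ x ∈ l, p (some x) = true) (hr : p rest.head? = false) (v : Reg) {S : Stk → List Γ'}
    (hS : S a = l ++ rest) :
    Exec (transfer p a b) v S { v with c := rest.head? }
      (Function.update (Function.update S a rest) b (l.reverse ++ S b)) (l.length + 1) := by
  induction l generalizing v S with
  | nil =>
    refine (exec_whileTop_exit (by rw [hS]; rfl) hr).of_eq rfl ?_ le_add_self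
    rw [show rest = S a from hS.symm, Function.update_eq_self]
    simp
  | cons x l ih =>
    have h1 : (S a).head? = some x := by rw [hS]; rfl
    have hbody := Prog.exec_eval (c := .seq (popSymbol a) (pushSymbol b)) rfl
      { v with c := some x } S
    simp only [Prog.eval, popSymbol, pushSymbol, h1, Option.getD_some,
      Function.update_of_ne hab.symm] at hbody
    refine (exec_whileTop_step h1 (hl x (by simp)) hbody
      (ih (fun y hy => hl y (List.mem_cons_of_mem _ hy)) _
        (by simp [Function.update_of_ne hab, hS]))).of_eq rfl ?_ (by simp)
    funext k
    by_cases hk : k = b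
    · subst hk
      simp
    · by_cases hk' : k = a
      · subst hk'
        simp [hab]
      · simp [hk, hk']

theorem exec_discard {p : Option Γ' → Bool} {a : Stk} {l rest : List Γ'}
    (hl : ∀ x ∈ l, p (some x) = true) (hr : p rest.head? = false) (v : Reg) {S : Stk → List Γ'}
    (hS : S a = l ++ rest) :
    Exec (discard p a) v S { v with c := rest.head? } (Function.update S a rest)
      (l.length + 1) := by
  induction l generalizing v S with
  | nil =>
    refine (exec_whileTop_exit (by rw [hS]; rfl) hr).of_eq rfl ?_ le_add_self
    rw [show rest = S a from hS.symm, Function.update_eq_self]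
  | cons x l ih =>
    have h1 : (S a).head? = some x := by rw [hS]; rfl
    have hbody := Prog.exec_eval (c := popSymbol a) rfl { v with c := some x } S
    simp only [Prog.eval, popSymbol, h1] at hbody
    exact (exec_whileTop_step h1 (hl x (by simp)) hbody
      (ih (fun y hy => hl y (List.mem_cons_of_mem _ hy)) _
        (by simp [hS]))).of_eq rfl (by simp) (by simp)

/-- Move a whole stack to another one. -/
def move (a b : Stk) : Code := transfer Option.isSome a b

/-- Empty a stack. -/
def clear (a : Stk) : Code := discard Option.isSome a

theorem exec_move {a b : Stk} (hab : a ≠ b) (v : Reg) (S : Stk → List Γ') :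
    Exec (move a b) v S { v with c := none }
      (Function.update (Function.update S a []) b ((S a).reverse ++ S b)) ((S a).length + 1) :=
  exec_transfer hab (fun _ _ => rfl) rfl v (List.append_nil _).symm

theorem exec_clear (a : Stk) (v : Reg) (S : Stk → List Γ') :
    Exec (clear a) v S { v with c := none } (Function.update S a []) ((S a).length + 1) :=
  exec_discard (fun _ _ => rfl) rfl v (List.append_nil _).symm

/-- Move the first bit string of a coded list to the stack `P`. -/
def readKey (k : Stk) : Code := .seq (transfer isBit k .Z) (.seq (popSymbol k) (move .Z .P))

theorem exec_readKey_X (v : Reg) (b : List Bool) (x r t y q : List Γ') :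
    Exec (readKey .X) v (st (codeWord b ++ x) r t y [] [] q) { v with c := none }
      (st x r t y [] (b.map .bit) q) (2 * b.length + 2) := by
  -- The digits are reversed on their way to `Z` and again on their way to `P`, so they arrive in
  -- order.
  have h1 := exec_transfer (p := isBit) (a := .X) (b := .Z) (by decide)
    (fun _ h => isBit_of_mem_map h) (rest := .comma :: x) rfl v
    (S := st (codeWord b ++ x) r t y [] [] q) (l := b.map .bit) (by simp [codeWord])
  have h2 := Prog.exec_eval (c := popSymbol .X) rfl { v with c := some .comma }
    (st (.comma :: x) r t y (b.map .bit).reverse [] q)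
  have h3 := exec_move (a := .Z) (b := .P) (by decide) { v with c := some .comma }
    (st x r t y (b.map .bit).reverse [] q)
  simp [Prog.eval, popSymbol] at h1 h2 h3
  exact (h1.seq (h2.seq h3)).of_eq rfl (by simp) (by omega)

theorem exec_readKey_R (v : Reg) (b : List Bool) (x r t y q : List Γ') :
    Exec (readKey .R) v (st x (codeWord b ++ r) t y [] [] q) { v with c := none }
      (st x r t y [] (b.map .bit) q) (2 * b.length + 2) := by
  have h1 := exec_transfer (p := isBit) (a := .R) (b := .Z) (by decide)
    (fun _ h => isBit_of_mem_map h) (rest := .comma :: r) rfl v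
    (S := st x (codeWord b ++ r) t y [] [] q) (l := b.map .bit) (by simp [codeWord])
  have h2 := Prog.exec_eval (c := popSymbol .R) rfl { v with c := some .comma }
    (st x (.comma :: r) t y (b.map .bit).reverse [] q)
  have h3 := exec_move (a := .Z) (b := .P) (by decide) { v with c := some .comma }
    (st x r t y (b.map .bit).reverse [] q)
  simp [Prog.eval, popSymbol] at h1 h2 h3
  exact (h1.seq (h2.seq h3)).of_eq rfl (by simp) (by omega)

/-! ### Comparing words and replacing them in a list -/

/-- Compare the digits on top of `X` with the digits in `P`, moving those of `X` to `Y` and those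
of `P` to `Z`. -/
def compareDigits : Code :=
  whileTop isBit .X (.seq (popSymbol .X) (.seq (pushSymbol .Y)
    (.seq (.pop .P fun v o => { v with d := o, eq := v.eq && o == v.c })
      (.ite (fun v => v.d.isSome) (.push .Z fun v => v.d.getD .blank) .skip))))

theorem exec_compareDigits (e p : List Bool) (v : Reg) (x r t y z q : List Γ') :
    ∃ d, Exec compareDigits v (st (codeWord e ++ x) r t y z (p.map .bit) q)
      { v with c := some .comma, d := d, eq := v.eq && e.isPrefixOf p }
      (st (.comma :: x) r t ((e.map .bit).reverse ++ y)
        (((p.take e.length).map .bit).reverse ++ z) ((p.drop e.length).map .bit) q)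
      (e.length + 1) := by
  induction e generalizing p v y z with
  | nil =>
    refine ⟨v.d, (exec_whileTop_exit (o := some .comma) rfl rfl).of_eq ?_ ?_ le_add_self⟩
    · simp
    · simp [codeWord]
  | cons b e ih =>
    cases p with
    | nil =>
      -- `P` is exhausted before the digits of `X`: the comparison fails from here on.
      obtain ⟨d, h⟩ := ih [] { v with c := some (.bit b), d := none, eq := false }
        (.bit b :: y) z
      refine ⟨d, (exec_whileTop_step (o := some (.bit b)) (s := 0) rfl rfl
        (Prog.exec_of_eval_eq rfl ?_) h).of_eq ?_ ?_ (by simp)⟩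
      · simp [Prog.eval, popSymbol, pushSymbol, codeWord]
      · simp
      · simp
    | cons b' p =>
      obtain ⟨d, h⟩ := ih p
        { v with c := some (.bit b), d := some (.bit b'), eq := v.eq && b == b' }
        (.bit b :: y) (.bit b' :: z)
      refine ⟨d, (exec_whileTop_step (o := some (.bit b)) (s := 0) rfl rfl
        (Prog.exec_of_eval_eq rfl ?_) h).of_eq ?_ ?_ (by simp)⟩
      · cases b <;> cases b' <;> simp [Prog.eval, popSymbol, pushSymbol, codeWord]
      · simp [Bool.and_assoc, List.isPrefixOf]
      · simp

/-- The digit loop only detects that `e` is a prefix of `p`; equality also needs that nothing is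
left in `P`. -/
theorem isPrefixOf_and_drop (e p : List Bool) :
    (e.isPrefixOf p && ((p.drop e.length).map Γ'.bit).head?.isNone) = decide (e = p) := by
  induction e generalizing p with
  | nil => cases p <;> simp
  | cons b e ih =>
    cases p with
    | nil => simp
    | cons b' p =>
      have := ih p
      by_cases hb : b = b' <;> simp_all

/-- Compare the first bit string of the list coded in `X` with the one in `P`; its digits are moved
to `Y`, and `P` is restored. -/
def compare : Code :=
  .seq (.load fun v => { v with eq := true }) (.seq compareDigits (.seq (popSymbol .X)
    (.seq (.peek .P fun v o => { v with d := none, eq := v.eq && o.isNone }) (move .Z .P))))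

theorem exec_compare (e p : List Bool) (v : Reg) (x r t y q : List Γ') :
    Exec compare v (st (codeWord e ++ x) r t y [] (p.map .bit) q)
      { v with c := none, d := none, eq := decide (e = p) }
      (st x r t ((e.map .bit).reverse ++ y) [] (p.map .bit) q) (2 * e.length + 2) := by
  obtain ⟨d, h⟩ := exec_compareDigits e p { v with eq := true } x r t y [] q
  have h2 := Prog.exec_eval (c := popSymbol .X) rfl
    { v with c := some .comma, d := d, eq := e.isPrefixOf p }
    (st (.comma :: x) r t ((e.map .bit).reverse ++ y)
        (((p.take e.length).map .bit).reverse ++ []) ((p.drop e.length).map .bit) q)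
  have h3 := Prog.Exec.peek .P (fun v o => { v with d := none, eq := v.eq && o.isNone })
    { v with c := some .comma, d := d, eq := e.isPrefixOf p }
    (st x r t ((e.map .bit).reverse ++ y)
        (((p.take e.length).map .bit).reverse ++ []) ((p.drop e.length).map .bit) q)
  have h4 := exec_move (a := .Z) (b := .P) (by decide)
    { v with c := some .comma, d := none, eq := decide (e = p) }
    (st x r t ((e.map .bit).reverse ++ y)
        (((p.take e.length).map .bit).reverse ++ []) ((p.drop e.length).map .bit) q)
  simp only [Bool.true_and, isPrefixOf_and_drop, st_P] at h h3
  simp only [Prog.eval, popSymbol, st_X, List.head?_cons, List.tail_cons, update_st_X] at h2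
  refine ((Prog.Exec.load _ _ _).seq (h.seq (h2.seq (h3.seq h4)))).of_eq rfl ?_ ?_
  · simp
  · simp only [st_Z, List.length_append, List.length_reverse, List.length_map, List.length_take,
      List.length_nil]
    omega

/-- Scan the list coded in `X`, copying it to `Y`; members that are equal to the bit string in `P`
are treated by `om`, and it is recorded that there are any. -/
def scan (om : Code) : Code :=
  .loop .X (fun v o => { v with c := o, d := none, eq := false }) (fun v => v.c.isSome)
    (.seq compare (.ite (fun v => v.eq) (.seq (.load fun v => { v with g := true }) om)
      (pushComma .Y)))

/-- `om` replaces the bit string on top of `Y` by `sub`. -/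
def Replaces (om : Code) (p q : List Bool) (sub : List (List Bool)) (n K : ℕ) : Prop :=
  ∀ (v : Reg) (x r t : List Γ') (e : List Bool) (y : List (List Bool)), e.length ≤ n →
    Exec om v (st x r t ((e.map .bit).reverse ++ (code y).reverse) [] (p.map .bit) (q.map .bit))
      { v with c := none }
      (st x r t (code (y ++ sub)).reverse [] (p.map .bit) (q.map .bit)) K

/-- The result of replacing `p` by `sub` in a list. -/
def substitute (p : List Bool) (sub l : List (List Bool)) : List (List Bool) :=
  l.flatMap fun e => if e = p then sub else [e]

theorem exec_scan {om : Code} {p q : List Bool} {sub : List (List Bool)} {n K : ℕ}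
    (hom : Replaces om p q sub n K) (l y : List (List Bool)) (hl : ∀ e ∈ l, e.length ≤ n)
    (v : Reg) (r t : List Γ') :
    Exec (scan om) v (st (code l) r t (code y).reverse [] (p.map .bit) (q.map .bit))
      { v with c := none, d := none, eq := false, g := v.g || decide (p ∈ l) }
      (st [] r t (code (y ++ substitute p sub l)).reverse [] (p.map .bit) (q.map .bit))
      (l.length * (2 * n + K + 3) + 1) := by
  induction l generalizing v y with
  | nil =>
    refine (Prog.Exec.loop_exit (by rfl)).of_eq ?_ ?_ le_add_self
    · simp [code]
    · simp [code, substitute]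
  | cons e l ih =>
    simp only [List.mem_cons, forall_eq_or_imp] at hl
    obtain ⟨he, hl⟩ := hl
    have hhead : ∃ o, (code (e :: l)).head? = some o := by
      rcases e with _ | ⟨b, e⟩ <;> exact ⟨_, rfl⟩
    obtain ⟨o, ho⟩ := hhead
    have hcmp := exec_compare e p { v with c := some o, d := none, eq := false } (code l) r t
      (code y).reverse (q.map .bit)
    by_cases hep : e = p
    · have h := ih (y ++ sub) hl { v with c := none, d := none, eq := true, g := true }
      refine (Prog.Exec.loop_step (s := 2 * n + 2 + K) ?_ ?_ h).of_eq ?_ ?_ ?_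
      · simp [ho]
      · simp only [st_X, ho]
        refine (hcmp.seq (.ite_true (by simp [hep])
          ((Prog.Exec.load _ _ _).seq (hom _ _ _ _ e y he)))).of_eq ?_ rfl (by omega)
        simp [hep]
      · simp [hep]
      · simp [substitute, hep]
      · simp only [List.length_cons]
        linarith
    · have h := ih (y ++ [e]) hl { v with c := none, d := none, eq := false }
      refine (Prog.Exec.loop_step (s := 2 * n + 2) ?_ ?_ h).of_eq ?_ ?_ ?_
      · simp [ho]
      · simp only [st_X, ho]
        refine (hcmp.seq (.ite_false (by simp [hep]) (Prog.Exec.push _ _ _ _))).of_eq ?_ ?_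
          (by omega)
        · simp [hep]
        · simp [code, codeWord]
      · simp [Ne.symm hep]
      · simp [substitute, hep]
      · simp only [List.length_cons]
        linarith

/-- Remove the bit string on top of `Y`. -/
def dropMatch : Code := .seq (discard isBit .Y) (.load fun v => { v with c := none })

theorem exec_dropMatch (v : Reg) (x r t : List Γ') (e : List Bool) (y : List (List Bool))
    (p q : List Γ') :
    Exec dropMatch v (st x r t ((e.map .bit).reverse ++ (code y).reverse) [] p q)
      { v with c := none } (st x r t (code y).reverse [] p q) (e.length + 1) := by
  have h := exec_discard (p := isBit) (a := .Y) (l := (e.map .bit).reverse)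
    (rest := (code y).reverse) (fun x hx => isBit_of_mem_map (List.mem_reverse.1 hx))
    (isBit_head?_reverse_code y) v
    (S := st x r t ((e.map .bit).reverse ++ (code y).reverse) [] p q) rfl
  exact (h.seq (.load _ _ _)).of_eq rfl (by simp) (by simp)

/-- Replace the bit string on top of `Y` by the one in `Q`. -/
def replaceMatch : Code :=
  .seq dropMatch (.seq (whileTop Option.isSome .Q (.seq (popSymbol .Q)
    (.seq (pushSymbol .Y) (pushSymbol .Z)))) (.seq (move .Z .Q) (pushComma .Y)))

theorem exec_copy (v : Reg) (x r t y z p q : List Γ') :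
    Exec (whileTop Option.isSome .Q (.seq (popSymbol .Q) (.seq (pushSymbol .Y) (pushSymbol .Z))))
      v (st x r t y z p q) { v with c := none } (st x r t (q.reverse ++ y) (q.reverse ++ z) p [])
      (q.length + 1) := by
  induction q generalizing v y z with
  | nil => exact (exec_whileTop_exit (o := none) rfl rfl).of_eq rfl rfl le_rfl
  | cons a q ih =>
    refine (exec_whileTop_step (o := some a) (s := 0) rfl rfl (Prog.exec_of_eval_eq rfl ?_)
      (ih { v with c := some a } (a :: y) (a :: z))).of_eq rfl (by simp) (by simp)
    simp [Prog.eval, popSymbol, pushSymbol]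

theorem replaces_dropMatch (p q : List Bool) (n : ℕ) :
    Replaces dropMatch p q [] n (n + 1) := by
  intro v x r t e y he
  exact (exec_dropMatch v x r t e y _ _).of_eq rfl (by simp) (by omega)

/-- The word in `Q` is copied to both `Y` and `Z`, and the copy in `Z` restores `Q`. -/
theorem replaces_replaceMatch (p q : List Bool) {n : ℕ} (hq : q.length ≤ n) :
    Replaces replaceMatch p q [q] n (3 * n + 3) := by
  intro v x r t e y he
  have h1 := exec_dropMatch v x r t e y (p.map .bit) (q.map .bit)
  have h2 := exec_copy { v with c := none } x r t (code y).reverse [] (p.map .bit) (q.map .bit)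
  have h3 := exec_move (a := .Z) (b := .Q) (by decide) { v with c := none }
    (st x r t ((q.map .bit).reverse ++ (code y).reverse) ((q.map .bit).reverse ++ [])
      (p.map .bit) [])
  refine (h1.seq (h2.seq (h3.seq (.push _ _ _ _)))).of_eq rfl ?_ ?_
  · simp [code, codeWord]
  · simp
    omega

theorem length_code_le {l : List (List Bool)} {N n : ℕ} (hl : ∀ e ∈ l, e.length ≤ n)
    (hN : l.length ≤ N) : (code l).length ≤ N * (n + 1) := by
  refine le_trans ?_ (Nat.mul_le_mul_right (n + 1) hN)
  clear hN
  induction l with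
  | nil => simp [code]
  | cons e l ih =>
    simp only [List.mem_cons, forall_eq_or_imp] at hl
    have := ih hl.2
    simp only [code, codeWord, List.flatMap_cons, List.length_append, List.length_map,
      List.length_cons, List.length_nil] at this ⊢
    linarith [hl.1]

/-- Apply `scan om` to the list that is coded in the stack `k`. -/
def rewriteStack (k : Stk) (om : Code) : Code :=
  .seq (move k .Y) (.seq (move .Y .X) (.seq (scan om) (move .Y k)))

/-- A bound on the cost of `rewriteStack`. -/
def rewriteCost (N n : ℕ) : ℕ := 3 * (N * (n + 1)) + N * (5 * n + 6) + 4

theorem length_substitute_le {p : List Bool} {sub l : List (List Bool)} (hsub : sub.length ≤ 1) :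
    (substitute p sub l).length ≤ l.length := by
  induction l with
  | nil => simp [substitute]
  | cons e l ih =>
    have h : (if e = p then sub else [e]).length ≤ 1 := by split_ifs <;> simp [hsub]
    rw [substitute] at ih ⊢
    rw [List.flatMap_cons, List.length_append, List.length_cons]
    omega

theorem length_le_of_mem_substitute {p : List Bool} {sub l : List (List Bool)} {n : ℕ}
    (hl : ∀ e ∈ l, e.length ≤ n) (hsub : ∀ e ∈ sub, e.length ≤ n) :
    ∀ e ∈ substitute p sub l, e.length ≤ n := by
  intro e he
  obtain ⟨a, ha, he⟩ := List.mem_flatMap.1 he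
  split_ifs at he
  · exact hsub e he
  · exact List.mem_singleton.1 he ▸ hl a ha

/-- Two moves of the old list, one scan of `M` words and one move of the new list; `2 * n + K + 3`
per word is at most `5 * n + 6`. -/
theorem rewriteCost_le {N n K L L' M : ℕ} (hK : K ≤ 3 * n + 3) (hL : L ≤ N * (n + 1))
    (hL' : L' ≤ N * (n + 1)) (hM : M ≤ N) :
    (L + 1) + ((L + 1) + ((M * (2 * n + K + 3) + 1) + (L' + 1))) ≤ rewriteCost N n := by
  have h : M * (2 * n + K + 3) ≤ N * (5 * n + 6) := Nat.mul_le_mul hM (by omega)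
  unfold rewriteCost
  omega

section

variable {om : Code} {p q : List Bool} {sub l : List (List Bool)} {N n K : ℕ}

theorem exec_rewriteStack_T (hom : Replaces om p q sub n K) (hK : K ≤ 3 * n + 3)
    (hl : ∀ e ∈ l, e.length ≤ n) (hN : l.length ≤ N) (hsub : sub.length ≤ 1)
    (hsub' : ∀ e ∈ sub, e.length ≤ n) (v : Reg) (r : List Γ') :
    Exec (rewriteStack .T om) v (st [] r (code l) [] [] (p.map .bit) (q.map .bit))
      { v with c := none, d := none, eq := false, g := v.g || decide (p ∈ l) }
      (st [] r (code (substitute p sub l)) [] [] (p.map .bit) (q.map .bit)) (rewriteCost N n) := by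
  have h1 := exec_move (a := .T) (b := .Y) (by decide) v
    (st [] r (code l) [] [] (p.map .bit) (q.map .bit))
  have h2 := exec_move (a := .Y) (b := .X) (by decide) { v with c := none }
    (st [] r [] (code l).reverse [] (p.map .bit) (q.map .bit))
  have h3 := exec_scan hom l [] hl { v with c := none } r []
  have h4 := exec_move (a := .Y) (b := .T) (by decide)
    { v with c := none, d := none, eq := false, g := v.g || decide (p ∈ l) }
    (st [] r [] (code (substitute p sub l)).reverse [] (p.map .bit) (q.map .bit))
  simp [code] at h1 h2 h3 h4
  refine (h1.seq (h2.seq (h3.seq h4))).of_eq rfl rfl ?_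
  simpa [code] using rewriteCost_le hK (length_code_le hl hN)
    (length_code_le (length_le_of_mem_substitute (p := p) hl hsub')
      ((length_substitute_le hsub).trans hN)) hN

theorem exec_rewriteStack_R (hom : Replaces om p q sub n K) (hK : K ≤ 3 * n + 3)
    (hl : ∀ e ∈ l, e.length ≤ n) (hN : l.length ≤ N) (hsub : sub.length ≤ 1)
    (hsub' : ∀ e ∈ sub, e.length ≤ n) (v : Reg) (t : List Γ') :
    Exec (rewriteStack .R om) v (st [] (code l) t [] [] (p.map .bit) (q.map .bit))
      { v with c := none, d := none, eq := false, g := v.g || decide (p ∈ l) }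
      (st [] (code (substitute p sub l)) t [] [] (p.map .bit) (q.map .bit)) (rewriteCost N n) := by
  have h1 := exec_move (a := .R) (b := .Y) (by decide) v
    (st [] (code l) t [] [] (p.map .bit) (q.map .bit))
  have h2 := exec_move (a := .Y) (b := .X) (by decide) { v with c := none }
    (st [] [] t (code l).reverse [] (p.map .bit) (q.map .bit))
  have h3 := exec_scan hom l [] hl { v with c := none } [] t
  have h4 := exec_move (a := .Y) (b := .R) (by decide)
    { v with c := none, d := none, eq := false, g := v.g || decide (p ∈ l) }
    (st [] [] t (code (substitute p sub l)).reverse [] (p.map .bit) (q.map .bit))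
  simp [code] at h1 h2 h3 h4
  refine (h1.seq (h2.seq (h3.seq h4))).of_eq rfl rfl ?_
  simpa [code] using rewriteCost_le hK (length_code_le hl hN)
    (length_code_le (length_le_of_mem_substitute (p := p) hl hsub')
      ((length_substitute_le hsub).trans hN)) hN

end

theorem substitute_nil (p : List Bool) (l : List (List Bool)) :
    substitute p [] l = l.filter (· ≠ p) := by
  induction l with
  | nil => rfl
  | cons e l ih =>
    rw [substitute] at ih ⊢
    rw [List.flatMap_cons, ih]
    by_cases h : e = p <;> simp [h]

theorem substitute_singleton (q p : List Bool) (l : List (List Bool)) :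
    substitute q [p] l = l.map (rename q p) := by
  induction l with
  | nil => rfl
  | cons e l ih =>
    rw [substitute] at ih ⊢
    rw [List.flatMap_cons, ih]
    by_cases h : e = q <;> simp [h, rename]

/-! ### Contracting rows on the stacks -/

/-- Contract the first row coded in `R`. -/
def contractRow : Code :=
  .seq (readKey .R)
  (.seq (.load fun v => { v with g := false })
  (.seq (rewriteStack .T dropMatch)
  (.seq (.load fun v => { v with f := v.g })
  (.seq (move .P .Z)
  (.seq (move .Z .Q)
  (.seq (readKey .R)
  (.seq (.load fun v => { v with g := false })
  (.seq (rewriteStack .T dropMatch)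
  (.seq (.load fun v => { v with f := v.f && v.g })
  (.seq (rewriteStack .R replaceMatch)
  (.seq (.ite (fun v => v.f) (.seq (pushComma .T) (.seq (move .Q .Z) (move .Z .T))) (clear .Q))
  (clear .P))))))))))))

/-- A bound on the cost of `contractRow`. -/
def contractCost (N n : ℕ) : ℕ := 3 * rewriteCost N n + 9 * n + 9

/-- The flag `f` records that `p` was needed and that `q` was still needed after removing `p`, which
also excludes `q = p`. Beyond the three rewrites, the cost is `4 * n + 4` for reading two words, `2
* n + 2` for moving `p` to `Q`, and `3 * n + 3` for the end. -/
theorem exec_contractRow {p q : List Bool} {R T : List (List Bool)} {N n : ℕ}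
    (hp : p.length ≤ n) (hq : q.length ≤ n) (hR : ∀ e ∈ R, e.length ≤ n) (hRN : R.length ≤ N)
    (hT : ∀ e ∈ T, e.length ≤ n) (hTN : T.length ≤ N) (v : Reg) :
    ∃ v', v'.ok = v.ok ∧ Exec contractRow v (st [] (code (p :: q :: R)) (code T) [] [] [] []) v'
      (st [] (code (R.map (rename q p))) (code (contractNeeds p q T)) [] [] [] [])
      (contractCost N n) := by
  have hT' : ∀ e ∈ T.filter (· ≠ p), e.length ≤ n := fun e he => hT e (List.mem_of_mem_filter he)
  have hTN' : (T.filter (· ≠ p)).length ≤ N := (List.length_filter_le _ _).trans hTN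
  have h1 := exec_readKey_R v p [] (code (q :: R)) (code T) [] []
  have h3 := exec_rewriteStack_T (replaces_dropMatch p [] n) (by omega) hT hTN (by simp) (by simp)
    { v with c := none, g := false } (code (q :: R))
  have h5 := exec_move (a := .P) (b := .Z) (by decide)
    { v with c := none, d := none, eq := false, g := decide (p ∈ T), f := decide (p ∈ T) }
    (st [] (code (q :: R)) (code (T.filter (· ≠ p))) [] [] (p.map .bit) [])
  have h6 := exec_move (a := .Z) (b := .Q) (by decide)
    { v with c := none, d := none, eq := false, g := decide (p ∈ T), f := decide (p ∈ T) }
    (st [] (code (q :: R)) (code (T.filter (· ≠ p))) [] (p.map .bit).reverse [] [])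
  have h7 := exec_readKey_R
    { v with c := none, d := none, eq := false, g := decide (p ∈ T), f := decide (p ∈ T) }
    q [] (code R) (code (T.filter (· ≠ p))) [] (p.map .bit)
  have h9 := exec_rewriteStack_T (replaces_dropMatch q p n) (by omega) hT' hTN' (by simp) (by simp)
    { v with c := none, d := none, eq := false, g := false, f := decide (p ∈ T) } (code R)
  have h11 := exec_rewriteStack_R (replaces_replaceMatch q p hp) (by omega) hR hRN (by simp)
    (by simpa using hp)
    { v with
      c := none, d := none, eq := false, g := decide (q ∈ T.filter (· ≠ p)),
      f := decide (p ∈ T) && decide (q ∈ T.filter (· ≠ p)) }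
    (code ((T.filter (· ≠ p)).filter (· ≠ q)))
  rw [substitute_nil] at h3 h9
  rw [substitute_singleton] at h11
  simp only [List.map_nil] at h3
  simp only [st_P, st_Z, update_st_P, update_st_Z, update_st_Q, List.append_nil,
    List.reverse_reverse, st_Q] at h5 h6
  have hfinal : ∀ w : Reg, w.f = (decide (p ∈ T) && decide (q ∈ T.filter (· ≠ p))) →
      ∃ w' : Reg, w'.ok = w.ok ∧ Exec
        (.seq (.ite (fun v => v.f) (.seq (pushComma .T) (.seq (move .Q .Z) (move .Z .T)))
          (clear .Q)) (clear .P)) w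
        (st [] (code (R.map (rename q p))) (code ((T.filter (· ≠ p)).filter (· ≠ q))) [] []
          (q.map .bit) (p.map .bit)) w'
        (st [] (code (R.map (rename q p))) (code (contractNeeds p q T)) [] [] [] [])
        (3 * n + 3) := by
    intro w hw
    by_cases hb : p ∈ T ∧ q ∈ T.filter (· ≠ p)
    · have h1 := exec_move (a := .Q) (b := .Z) (by decide) w
        (st [] (code (R.map (rename q p)))
          (.comma :: code ((T.filter (· ≠ p)).filter (· ≠ q))) [] [] (q.map .bit) (p.map .bit))
      have h2 := exec_move (a := .Z) (b := .T) (by decide) { w with c := none }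
        (st [] (code (R.map (rename q p)))
          (.comma :: code ((T.filter (· ≠ p)).filter (· ≠ q))) [] (p.map .bit).reverse
          (q.map .bit) [])
      have h3 := exec_clear .P { w with c := none }
        (st [] (code (R.map (rename q p))) (code (contractNeeds p q T)) [] []
          (q.map .bit) [])
      have hpush := Prog.Exec.push (Γ := Γ') Stk.T (fun _ => Γ'.comma) w
        (st [] (code (R.map (rename q p)))
          (code ((T.filter (· ≠ p)).filter (· ≠ q))) [] [] (q.map .bit) (p.map .bit))
      -- The comma is pushed first, since it lies below the digits of `p` on the stack.
      have hcode : (p.map Γ'.bit) ++ .comma :: code ((T.filter (· ≠ p)).filter (· ≠ q)) =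
          code (contractNeeds p q T) := by
        rw [contractNeeds, if_pos hb]
        simp [code, codeWord]
      simp only [st_P, st_Z, st_T, update_st_P, update_st_Z, update_st_Q, update_st_T,
        List.append_nil, List.reverse_reverse, st_Q, hcode, List.length_reverse,
        List.length_map] at h1 h2 h3 hpush
      refine ⟨{ w with c := none }, rfl, ((Prog.Exec.ite_true ?_
        (hpush.seq (h1.seq h2))).seq h3).weaken (by omega)⟩
      rw [hw, ← Bool.decide_and, decide_eq_true hb]
    · have hc : contractNeeds p q T = (T.filter (· ≠ p)).filter (· ≠ q) := by
        rw [contractNeeds, if_neg hb]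
      rw [hc]
      have h1 := exec_clear .Q w
        (st [] (code (R.map (rename q p)))
          (code ((T.filter (· ≠ p)).filter (· ≠ q))) [] [] (q.map .bit) (p.map .bit))
      have h3 := exec_clear .P { w with c := none }
        (st [] (code (R.map (rename q p)))
          (code ((T.filter (· ≠ p)).filter (· ≠ q))) [] [] (q.map .bit) [])
      simp only [st_P, update_st_P, update_st_Q, st_Q, List.length_map] at h1 h3
      refine ⟨{ w with c := none }, rfl,
        ((Prog.Exec.ite_false ?_ h1).seq h3).weaken (by omega)⟩
      rw [hw, ← Bool.decide_and, decide_eq_false hb]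
  obtain ⟨w', hw', hfinal⟩ := hfinal
    { v with
      c := none, d := none, eq := false,
      g := decide (q ∈ T.filter (· ≠ p)) || decide (q ∈ R),
      f := decide (p ∈ T) && decide (q ∈ T.filter (· ≠ p)) } rfl
  refine ⟨w', hw', ?_⟩
  have e10 := Prog.Exec.load (K := Stk) (Γ := Γ') (fun v : Reg => { v with f := v.f && v.g })
    { v with
      c := none, d := none, eq := false, g := decide (q ∈ T.filter (· ≠ p)),
      f := decide (p ∈ T) }
    (st [] (code R) (code ((T.filter (· ≠ p)).filter (· ≠ q))) [] [] (q.map .bit) (p.map .bit))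
  have e4 := Prog.Exec.load (K := Stk) (Γ := Γ') (fun v : Reg => { v with f := v.g })
    { v with c := none, d := none, eq := false, g := decide (p ∈ T) }
    (st [] (code (q :: R)) (code (T.filter (· ≠ p))) [] [] (p.map .bit) [])
  have := e10.seq (h11.seq hfinal)
  have := h7.seq (.seq (.load (fun v : Reg => { v with g := false }) _ _) (h9.seq this))
  have := e4.seq (h5.seq (h6.seq this))
  have := h1.seq (.seq (.load (fun v : Reg => { v with g := false }) _ _) (h3.seq this))
  refine this.weaken ?_
  simp only [List.length_map, List.length_reverse]
  unfold contractCost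
  omega

/-- Contract all the rows coded in `R`. -/
def contractRows : Code := whileTop Option.isSome .R contractRow

theorem head?_code_cons (e : List Bool) (l : List (List Bool)) :
    ∃ o, (code (e :: l)).head? = some o := by
  rcases e with _ | ⟨b, e⟩ <;> exact ⟨_, rfl⟩

theorem length_le_of_mem_contractNeeds {p q : List Bool} {T : List (List Bool)} {n : ℕ}
    (hT : ∀ e ∈ T, e.length ≤ n) : ∀ e ∈ contractNeeds p q T, e.length ≤ n := by
  intro e he
  rcases mem_contractNeeds.1 he with h | ⟨rfl, h, -⟩
  · exact hT e h.1
  · exact hT e h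

/-- The merged element is added only when at least one occurrence of `p` has been removed. -/
theorem length_contractNeeds_le {α : Type*} [DecidableEq α] (p q : α) (T : List α) :
    (contractNeeds p q T).length ≤ T.length := by
  unfold contractNeeds
  have h1 := List.length_filter_le (· ≠ q) (T.filter (· ≠ p))
  have h2 := List.length_filter_le (· ≠ p) T
  dsimp only
  split_ifs with h
  · have : (T.filter (· ≠ p)).length < T.length :=
      List.length_filter_lt_length_iff_exists.2 ⟨p, h.1, by simp⟩
    rw [List.length_cons]
    omega
  · omega

theorem flatten_map {α β : Type*} (f : α → β) (rows : List (α × α)) :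
    flatten (rows.map (Prod.map f f)) = (flatten rows).map f := by
  simp [flatten, List.flatMap_map, List.map_flatMap]

theorem length_rename_le {p q e : List Bool} {n : ℕ} (hp : p.length ≤ n) (he : e.length ≤ n) :
    (rename q p e).length ≤ n := by
  unfold rename
  split_ifs <;> assumption

/-- The bounds `N` and `n` survive a contraction: renaming only replaces a word by another of length
at most `n`, and the needs do not grow in number. So each row costs at most the same amount. -/
theorem exec_contractRows {rows : List (List Bool × List Bool)} {T : List (List Bool)} {N n : ℕ}
    (hR : ∀ e ∈ flatten rows, e.length ≤ n) (hRN : (flatten rows).length ≤ N)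
    (hT : ∀ e ∈ T, e.length ≤ n) (hTN : T.length ≤ N) (v : Reg) :
    ∃ v', v'.ok = v.ok ∧ Exec contractRows v (st [] (code (flatten rows)) (code T) [] [] [] []) v'
      (st [] [] (code (contractAll rows T)) [] [] [] [])
      (rows.length * (contractCost N n + 1) + 1) := by
  induction hm : rows.length generalizing rows T v with
  | zero =>
    obtain rfl := List.length_eq_zero_iff.1 hm
    refine ⟨{ v with c := none }, rfl, (exec_whileTop_exit (o := none) rfl rfl).of_eq rfl ?_
      le_add_self⟩
    rw [contractAll]
    rfl
  | succ m ih =>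
    match rows, hm with
    | (p, q) :: rows, hm =>
      have hflat : flatten ((p, q) :: rows) = p :: q :: flatten rows := rfl
      rw [hflat] at hR hRN ⊢
      simp only [List.mem_cons, forall_eq_or_imp, List.length_cons] at hR hRN hm
      obtain ⟨hp, hq, hR⟩ := hR
      obtain ⟨o, ho⟩ := head?_code_cons p (q :: flatten rows)
      obtain ⟨v', hv', h1⟩ := exec_contractRow hp hq hR (by omega) hT hTN { v with c := some o }
      have hR' : ∀ e ∈ flatten (rows.map (Prod.map (rename q p) (rename q p))),
          e.length ≤ n := by
        rw [flatten_map]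
        intro e he
        obtain ⟨a, ha, rfl⟩ := List.mem_map.1 he
        exact length_rename_le hp (hR a ha)
      obtain ⟨v'', hv'', h2⟩ := ih hR' (by rw [flatten_map, List.length_map]; omega)
        (length_le_of_mem_contractNeeds (p := p) (q := q) hT)
        ((length_contractNeeds_le p q T).trans hTN) v' (by simpa using hm)
      rw [flatten_map] at h2
      refine ⟨v'', hv''.trans hv', (exec_whileTop_step ho rfl h1 h2).of_eq rfl ?_ ?_⟩
      · rw [contractAll]
      · linarith

/-! ### The complete program and its running time -/

/-- Check that the two elements of each row coded in `X` are distinct, while moving the rows,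
with their elements exchanged, to `Y`. -/
def checkRows : Code :=
  whileTop Option.isSome .X (.seq (readKey .X) (.seq compare
    (.seq (.load fun v => { v with ok := v.ok && !v.eq })
      (.seq (pushComma .Y) (.seq (move .P .Y) (pushComma .Y))))))

theorem exec_checkRows {rows : List (List Bool × List Bool)} {n : ℕ}
    (hR : ∀ e ∈ flatten rows, e.length ≤ n) (v : Reg) (y : List (List Bool)) (t : List Γ') :
    ∃ v', v'.ok = (v.ok && decide (∀ e ∈ rows, e.1 ≠ e.2)) ∧
      Exec checkRows v (st (code (flatten rows)) [] t (code y).reverse [] [] []) v'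
        (st [] [] t (code (y ++ flatten (rows.map Prod.swap))).reverse [] [] [])
        (rows.length * (5 * n + 6) + 1) := by
  induction rows generalizing v y with
  | nil =>
    refine ⟨{ v with c := none }, by simp, (exec_whileTop_exit (o := none) rfl rfl).of_eq rfl ?_
      le_add_self⟩
    simp [flatten, code]
  | cons e rows ih =>
    obtain ⟨p, q⟩ := e
    have hflat : flatten ((p, q) :: rows) = p :: q :: flatten rows := rfl
    rw [hflat] at hR ⊢
    simp only [List.mem_cons, forall_eq_or_imp] at hR
    obtain ⟨hp, hq, hR⟩ := hR
    obtain ⟨o, ho⟩ := head?_code_cons p (q :: flatten rows)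
    have h1 := exec_readKey_X { v with c := some o } p (code (q :: flatten rows)) [] t
      (code y).reverse []
    have h2 := exec_compare q p { v with c := none } (code (flatten rows)) [] t
      (code y).reverse []
    have h3 := Prog.Exec.load (K := Stk) (Γ := Γ') (fun v : Reg => { v with ok := v.ok && !v.eq })
      { v with c := none, d := none, eq := decide (q = p) }
      (st (code (flatten rows)) [] t ((q.map .bit).reverse ++ (code y).reverse) []
        (p.map .bit) [])
    have h4 := Prog.Exec.push (Γ := Γ') Stk.Y (fun _ => Γ'.comma)
      { v with c := none, d := none, eq := decide (q = p), ok := v.ok && !decide (q = p) }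
      (st (code (flatten rows)) [] t ((q.map .bit).reverse ++ (code y).reverse) []
        (p.map .bit) [])
    have h5 := exec_move (a := .P) (b := .Y) (by decide)
      { v with c := none, d := none, eq := decide (q = p), ok := v.ok && !decide (q = p) }
      (st (code (flatten rows)) [] t
        (.comma :: ((q.map .bit).reverse ++ (code y).reverse)) [] (p.map .bit) [])
    have h6 := Prog.Exec.push (Γ := Γ') Stk.Y (fun _ => Γ'.comma)
      { v with c := none, d := none, eq := decide (q = p), ok := v.ok && !decide (q = p) }
      (st (code (flatten rows)) [] t
        ((p.map .bit).reverse ++ .comma :: ((q.map .bit).reverse ++ (code y).reverse)) [] [] [])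
    simp only [st_P, st_Y, update_st_P, update_st_Y, List.length_map] at h4 h5 h6
    -- The comparison has already put `q` on `Y` while `p` waits in `P`, so the row is written back
    -- as `(q, p)`.
    have hy : Γ'.comma :: ((p.map .bit).reverse ++ .comma ::
        ((q.map .bit).reverse ++ (code y).reverse)) = (code (y ++ [q, p])).reverse := by
      simp [code, codeWord]
    rw [hy] at h6
    obtain ⟨v', hv', h7⟩ := ih hR
      { v with c := none, d := none, eq := decide (q = p), ok := v.ok && !decide (q = p) }
      (y ++ [q, p])
    refine ⟨v', ?_, (exec_whileTop_step ho rfl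
      (h1.seq (h2.seq (h3.seq (h4.seq (h5.seq h6))))) h7).of_eq rfl ?_ ?_⟩
    · rw [hv', Bool.eq_iff_iff]
      simp only [Bool.and_eq_true, Bool.not_eq_true', decide_eq_true_eq, decide_eq_false_iff_not,
        List.forall_mem_cons, and_assoc, ne_eq, eq_comm (a := q)]
    · simp [flatten]
    · simp only [List.length_cons]
      linarith

/-- Read the input, moving the elements of the rows to `Y` and the elements that have to be picked
to `Z`. -/
def readInput : Code :=
  whileTop Option.isSome .X (.seq (popSymbol .X)
    (.seq (.ite (fun v => inRow v.s) (pushSymbol .Y) .skip)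
      (.seq (.ite (fun v => inNeeds v.s (v.c.getD .blank)) (pushSymbol .Z) .skip)
        (.load fun v => { v with s := advance v.s (v.c.getD .blank) }))))

theorem exec_readInput (w : List Γ') (v : Reg) (y z : List Γ') :
    Exec readInput v (st w [] [] y z [] []) { v with c := none, s := w.foldl advance v.s }
      (st [] [] [] ((rowSymbols v.s w).reverse ++ y) ((needSymbols v.s w).reverse ++ z) [] [])
      (w.length + 1) := by
  induction w generalizing v y z with
  | nil => exact (exec_whileTop_exit (o := none) rfl rfl).of_eq rfl rfl le_rfl
  | cons a w ih =>
    refine (exec_whileTop_step (o := some a) (s := 0) rfl rfl (Prog.exec_of_eval_eq rfl ?_)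
      (ih { v with c := some a, s := advance v.s a } (if inRow v.s then a :: y else y)
        (if inNeeds v.s a then a :: z else z))).of_eq rfl ?_ (by simp)
    · cases h1 : inRow v.s <;> cases h2 : inNeeds v.s a <;>
        simp [Prog.eval, popSymbol, pushSymbol, h1, h2]
    · rw [rowSymbols, needSymbols]
      split_ifs <;> simp

/-- The program that decides reachability. -/
def decideProgram : Code :=
  .seq readInput (.ite (fun v => accepting v.s)
    (.seq (move .Y .X) (.seq (move .Z .T) (.seq checkRows (.seq (move .Y .R) (.seq contractRows
      (.seq (.peek .T fun v o => { v with ok := v.ok && o.isNone }) (clear .T)))))))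
    (.seq (.load fun v => { v with ok := false }) (.seq (clear .Y) (clear .Z))))

/-- The register at the start. -/
def initialReg : Reg := ⟨none, none, false, false, false, true, (.row, none)⟩

theorem length_le_code {l : List (List Bool)} :
    l.length ≤ (code l).length ∧ ∀ e ∈ l, e.length ≤ (code l).length := by
  induction l with
  | nil => simp [code]
  | cons e l ih =>
    have h : (code (e :: l)).length = e.length + 1 + (code l).length := by
      simp only [code, codeWord, List.flatMap_cons, List.length_append, List.length_map,
        List.length_singleton]
    refine ⟨by rw [List.length_cons]; omega, ?_⟩
    simp only [List.mem_cons, forall_eq_or_imp]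
    exact ⟨by omega, fun a ha => (ih.2 a ha).trans (by omega)⟩

theorem length_flatten {α : Type*} (rows : List (α × α)) :
    (flatten rows).length = 2 * rows.length := by
  induction rows with
  | nil => rfl
  | cons e rows ih =>
    change (flatten rows).length + 2 = _
    rw [ih, List.length_cons]
    ring

theorem mem_flatten_swap {α : Type*} {rows : List (α × α)} {x : α} :
    x ∈ flatten (rows.map Prod.swap) ↔ x ∈ flatten rows := by
  simp only [flatten, List.mem_flatMap, List.mem_map, Prod.exists, Prod.swap_prod_mk,
    List.mem_cons, List.not_mem_nil, or_false]
  constructor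
  · rintro ⟨_, _, ⟨a, b, h, h'⟩, hx⟩
    obtain ⟨rfl, rfl⟩ := Prod.mk.inj h'
    exact ⟨a, b, h, hx.symm⟩
  · rintro ⟨a, b, h, hx⟩
    exact ⟨b, a, ⟨a, b, h, rfl⟩, hx.symm⟩

theorem head?_code_isNone (l : List (List Bool)) :
    (code l).head?.isNone = decide (l = []) := by
  rcases l with _ | ⟨e, l⟩
  · rfl
  · obtain ⟨o, ho⟩ := head?_code_cons e l
    rw [ho]
    simp

/-- A bound on the cost of `decideProgram`. -/
noncomputable def decideTime : Polynomial ℕ :=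
  let X : Polynomial ℕ := Polynomial.X
  X * (3 * (3 * (X * (X + 1)) + X * (5 * X + 6) + 4) + 9 * X + 10) + X * (5 * X + 6) +
    (X * (X + 1)) + 5 * X + 10

theorem eval_decideTime (n : ℕ) : decideTime.eval n =
    n * (contractCost n n + 1) + n * (5 * n + 6) + n * (n + 1) + 5 * n + 10 := by
  simp [decideTime, contractCost, rewriteCost]

/-- Bounds the cost of emptying `T` at the end: the surviving needs are original ones. -/
theorem length_contractAll_le {α : Type*} [DecidableEq α] (rows : List (α × α)) (T : List α) :
    (contractAll rows T).length ≤ T.length ∧ ∀ x ∈ contractAll rows T, x ∈ T := by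
  induction hm : rows.length generalizing rows T with
  | zero =>
    obtain rfl := List.length_eq_zero_iff.1 hm
    rw [contractAll]
    exact ⟨le_rfl, fun _ h => h⟩
  | succ m ih =>
    match rows, hm with
    | (p, q) :: rows, hm =>
      rw [contractAll]
      obtain ⟨h1, h2⟩ := ih (rows.map (Prod.map (rename q p) (rename q p)))
        (contractNeeds p q T) (by simpa using hm)
      refine ⟨h1.trans (length_contractNeeds_le p q T), fun x hx => ?_⟩
      rcases mem_contractNeeds.1 (h2 x hx) with h | ⟨rfl, h, -⟩
      · exact h.1
      · exact h

/-- The length of the input bounds the number of rows, the numbers of coded words and their lengths,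
so it serves for both `N` and `n`. -/
theorem exec_decideProgram_of_accepting {rows : List (List Bool × List Bool)}
    {D : List (List Bool)} (hr : ∀ e ∈ rows, Canonical e.1 ∧ Canonical e.2)
    (hD : ∀ b ∈ D, Canonical b) :
    ∃ v', Exec decideProgram initialReg (st (instanceWord rows D) [] [] [] [] [] []) v'
      (st [] [] [] [] [] [] []) (decideTime.eval (instanceWord rows D).length) ∧
      (v'.ok = true ↔ (∀ e ∈ rows, e.1 ≠ e.2) ∧
        contractAll rows (rows.map Prod.fst ++ D) = []) := by
  obtain ⟨hacc, hrow, hneed⟩ := read_instanceWord hr hD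
  set w := instanceWord rows D with hw
  set n := w.length with hn
  set T := rows.map Prod.fst ++ D with hTdef
  have hcR : (code (flatten rows)).length ≤ n := hrow ▸ length_rowSymbols_le _ w
  have hcT : (code T).length ≤ n := hneed ▸ length_needSymbols_le _ w
  have hR : ∀ e ∈ flatten rows, e.length ≤ n := fun e he => (length_le_code.2 e he).trans hcR
  have hRN : (flatten rows).length ≤ n := length_le_code.1.trans hcR
  have hT : ∀ e ∈ T, e.length ≤ n := fun e he => (length_le_code.2 e he).trans hcT
  have hTN : T.length ≤ n := length_le_code.1.trans hcT
  have hrows : rows.length ≤ n := by rw [length_flatten] at hRN; omega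
  have h1 := exec_readInput w initialReg [] []
  rw [show initialReg.s = (.row, none) from rfl, hrow, hneed] at h1
  set v1 : Reg := { initialReg with c := none, s := w.foldl advance (.row, none) } with hv1
  have h2 := exec_move (a := .Y) (b := .X) (by decide) v1
    (st [] [] [] ((code (flatten rows)).reverse ++ []) ((code T).reverse ++ []) [] [])
  have h3 := exec_move (a := .Z) (b := .T) (by decide) { v1 with c := none }
    (st (code (flatten rows)) [] [] [] ((code T).reverse ++ []) [] [])
  obtain ⟨v4, hv4, h4⟩ := exec_checkRows hR { v1 with c := none } [] (code T)
  have h5 := exec_move (a := .Y) (b := .R) (by decide) v4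
    (st [] [] (code T) (code ([] ++ flatten (rows.map Prod.swap))).reverse [] [] [])
  obtain ⟨v6, hv6, h6⟩ := exec_contractRows (rows := rows.map Prod.swap) (N := n) (n := n)
    (fun e he => hR e (mem_flatten_swap.1 he))
    (by rw [length_flatten, List.length_map, ← length_flatten]; exact hRN) hT hTN
    { v4 with c := none }
  set T' := contractAll (rows.map Prod.swap) T with hT'
  have h7 := Prog.Exec.peek (Γ := Γ') Stk.T (fun (v : Reg) o => { v with ok := v.ok && o.isNone })
    v6 (st [] [] (code T') [] [] [] [])
  have h8 := exec_clear .T { v6 with ok := v6.ok && (code T').head?.isNone }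
    (st [] [] (code T') [] [] [] [])
  simp only [List.nil_append, List.append_nil, st_X, st_Y, st_Z, st_T, st_R, update_st_X,
    update_st_Y, update_st_Z, update_st_T, update_st_R, List.reverse_reverse,
    List.length_reverse] at h1 h2 h3 h4 h5 h7 h8
  have hok := head?_code_isNone T'
  have hT'N : (code T').length ≤ n * (n + 1) := by
    obtain ⟨ha, hb⟩ := length_contractAll_le (rows.map Prod.swap) T
    exact length_code_le (fun e he => hT e (hb e he)) (ha.trans hTN)
  refine ⟨_, (h1.seq (.ite_true hacc (h2.seq (h3.seq (h4.seq (h5.seq (h6.seq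
    (h7.seq h8)))))))).weaken ?_, ?_⟩
  · have hc : (code (flatten (rows.map Prod.swap))).length ≤ n := by
      refine le_trans (le_of_eq ?_) hcR
      clear * -
      induction rows with
      | nil => rfl
      | cons e rows ih =>
        simp only [code, flatten, List.map_cons, List.flatMap_cons, List.flatMap_append,
          List.length_append] at ih ⊢
        simp only [Prod.fst_swap, Prod.snd_swap, List.flatMap_nil, List.length_nil, add_zero]
        omega
    have e1 : rows.length * (5 * n + 6) ≤ n * (5 * n + 6) := Nat.mul_le_mul_right _ hrows
    have e2 : rows.length * (contractCost n n + 1) ≤ n * (contractCost n n + 1) :=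
      Nat.mul_le_mul_right _ hrows
    rw [eval_decideTime, List.length_map]
    omega
  -- Only the emptiness of the result is claimed to be unaffected by the exchange of entries; the
  -- needs were collected from the original first entries.
  · have hswap : T' = [] ↔ contractAll rows T = [] := by
      rw [hT', ← saturable_iff_contractAll_eq_nil, ← saturable_iff_contractAll_eq_nil,
        saturable_map_swap_iff]
    dsimp only
    rw [hok, hv6]
    dsimp only
    rw [hv4, ← hswap]
    simp [hv1, initialReg]

theorem exec_decideProgram_of_not_accepting {w : List Γ'}
    (hw : ¬ accepting (w.foldl advance (.row, none)) = true) :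
    ∃ v', Exec decideProgram initialReg (st w [] [] [] [] [] []) v'
      (st [] [] [] [] [] [] []) (decideTime.eval w.length) ∧ v'.ok = false := by
  have h1 := exec_readInput w initialReg [] []
  set v1 : Reg := { initialReg with c := none, s := w.foldl advance initialReg.s } with hv1
  set y := (rowSymbols initialReg.s w).reverse ++ [] with hy
  set z := (needSymbols initialReg.s w).reverse ++ [] with hz
  have h2 := exec_clear .Y { v1 with ok := false } (st [] [] [] y z [] [])
  have h3 := exec_clear .Z { v1 with ok := false, c := none } (st [] [] [] [] z [] [])
  have hyl : y.length ≤ w.length := by simpa [hy] using length_rowSymbols_le initialReg.s w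
  have hzl : z.length ≤ w.length := by simpa [hz] using length_needSymbols_le initialReg.s w
  simp only [st_Y, st_Z, update_st_Y, update_st_Z] at h2 h3
  refine ⟨_, (h1.seq (.ite_false (Bool.eq_false_iff.2 hw)
    (.seq (.load (fun v : Reg => { v with ok := false }) _ _) (h2.seq h3)))).weaken ?_, rfl⟩
  rw [eval_decideTime]
  omega

/-- A rejected word is no encoding of an instance; an accepted one outside the language is an
encoding that violates distinctness or reachability, which the program detects. -/
theorem inP_decidingReachability : InP (decidingReachability 2) := by
  refine Prog.inP_of_exec decideProgram .X initialReg Reg.ok _ decideTime fun w => ?_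
  have h1 : Function.update (fun _ => []) Stk.X w = st w [] [] [] [] [] [] := by
    funext k; cases k <;> rfl
  have h2 : (fun _ => []) = st [] [] [] [] [] [] [] := by
    funext k; cases k <;> rfl
  rw [h1, h2]
  by_cases hL : w ∈ decidingReachability 2
  · obtain ⟨rows, D, rfl, hr, hD, h⟩ := mem_decidingReachability_iff.1 hL
    obtain ⟨v', hv', hok⟩ := exec_decideProgram_of_accepting hr hD
    exact ⟨v', hv', iff_of_true (hok.2 h) hL⟩
  by_cases hw : accepting (w.foldl advance (.row, none)) = true
  · obtain ⟨rows, D, hr, hD, rfl⟩ := continues_of_accepting w _ hw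
    obtain ⟨v', hv', hok⟩ := exec_decideProgram_of_accepting hr hD
    refine ⟨v', hv', iff_of_false (fun h => hL ?_) hL⟩
    exact mem_decidingReachability_iff.2 ⟨rows, D, rfl, hr, hD, hok.1 h⟩
  · obtain ⟨v', hv', hok⟩ := exec_decideProgram_of_not_accepting hw
    exact ⟨v', hv', iff_of_false (by simp [hok]) hL⟩

end HouseAllocation

/-! ### The theorem -/

theorem mainTheorem6 :
    HouseAllocation.InP (HouseAllocation.decidingReachability 2) ∧
    ∀ (A B : Type*) [Finite A] (M : Matrix A (Fin 2) B),
      HouseAllocation.IsPreferenceMatrix M →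
      -- the components can be treated separately
      (∀ D : Set B, HouseAllocation.Reachable M D ↔
        ∀ C : (HouseAllocation.rowElementGraph M).ConnectedComponent,
          HouseAllocation.Reachable M (D ∩ HouseAllocation.componentElements C)) ∧
      ∀ C : (HouseAllocation.rowElementGraph M).ConnectedComponent,
        (HouseAllocation.componentElements C).Finite ∧
        (HouseAllocation.componentElements C).ncard ≤
          (HouseAllocation.componentRows C).ncard + 1 ∧
        (C.toSimpleGraph.IsTree ↔ (HouseAllocation.componentElements C).ncard =
          (HouseAllocation.componentRows C).ncard + 1) ∧
        (C.toSimpleGraph.IsTree → ∀ D : Set B,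
          (HouseAllocation.Reachable M (D ∩ HouseAllocation.componentElements C) ↔
            ∃ x ∈ HouseAllocation.componentElements C,
              HouseAllocation.Avoidable M x ∧ x ∉ D)) ∧
        (¬ C.toSimpleGraph.IsTree →
          HouseAllocation.Reachable M (HouseAllocation.componentElements C)) := by
  refine ⟨HouseAllocation.inP_decidingReachability, fun A B _ M hM => ?_⟩
  refine ⟨HouseAllocation.reachable_iff_forall_component hM, fun C => ?_⟩
  exact ⟨HouseAllocation.componentElements_finite C, HouseAllocation.ncard_componentElements_le C,
    HouseAllocation.isTree_component_iff hM C,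
    fun hC => HouseAllocation.reachable_inter_iff_of_isTree hM C hC,
    HouseAllocation.reachable_componentElements_of_not_isTree hM C⟩
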